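/- Setting. There are $n\ge 1$ papers $\mathcal P=[n]$, $n_R$ reviewers $\mathcal R=[n_R]$, and a similarity matrix $S\in[0,1]^{n_R\times n}$. For $\mathcal R'\subseteq\mathcal R$, $\mathcal P'\subseteq\mathcal P$, a reviewer load $\ell_{rev}\in\mathbb Z_+$ and a real paper load $\ell_{pap}>0$, let $\mathcal M(\mathcal R',\mathcal P';\ell_{rev},\ell_{pap})$ be the set of matrices $A\in\{0,1\}^{n_R\times n}$ such that $\lfloor\ell_{pap}\rfloor\le\sum_{r\in\mathcal R'}A_{rp}\le\lceil\ell_{pap}\rceil$ for all $p\in\mathcal P'$ (so $\sum_{r\in\mathcal R'}A_{rp}=\ell_{pap}$ if $\ell_{pap}$ is an integer), $\sum_{p\in\mathcal P'}A_{rp}\le\ell_{rev}$ for all $r\in\mathcal R'$, and $A_{rp}=0$ for $(r,p)\notin\mathcal R'\times\mathcal P'$. The mean similarity of $A\in\mathcal M(\mathcal R,\mathcal P;\ell_{rev},\ell_{pap})$ is $\frac1{\ell_{pap}n}\sum_{r,p}A_{rp}S_{rp}$. For $\mathcal R_2\subseteq\mathcal R$ and $\mathcal P_2\subseteq\mathcal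 P$ let $$Q(\mathcal R_2,\mathcal P_2)=\frac1{n+|\mathcal P_2|}\Big[\max_{A\in\mathcal M(\mathcal R\setminus\mathcal R_2,\mathcal P;1,1)}\sum_{r,p}A_{rp}S_{rp}+\max_{B\in\mathcal M(\mathcal R_2,\mathcal P_2;1,1)}\sum_{r,p}B_{rp}S_{rp}\Big].$$ Theorem. Let $\mu\in\{1,\dots,10000\}$ and $\beta\in\{\frac1{100},\dots,\frac{100}{100}\}$, and suppose that $\beta n$ and $\frac{\beta}{1+\beta}n_R$ are integers and $n_R\ge(1+\beta)n$ (the basic case is $n_R=(1+\beta)n$, where $\frac{\beta}{1+\beta}n_R=\beta n$). Let $f(\mathcal R_2)$ be the expectation of $Q(\mathcal R_2,\mathcal P_2)$ when $\mathcal P_2$ is uniformly distributed over the $\beta n$-element subsets of $\mathcal P$, and let $\mathcal R_2$ be chosen by random split, that is, uniformly among the $\frac{\beta}{1+\beta}n_R$-element subsets of $\mathcal R$. Suppose that some assignment $A^{(\mu)}\in\mathcal M(\mathcal R,\mathcal P;\mu,(1+\beta)\mu)$ has mean similarity $s^{(\mu)}$. (a) If $\beta\mu$ is an integer, then $$\mathbb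 E_{\mathcal R_2}[f(\mathcal R_2)]\ \ge\ s^{(\mu)}\Big[1-\sqrt{\tfrac{\beta}{2\pi(1+\beta)^2\mu}}\Big(2\sqrt{\tfrac1{1+\beta}}+\sqrt{1-\beta}\Big)\Big].$$ (b) In general, with $\epsilon=\lceil\beta\mu\rceil-\lfloor\beta\mu\rfloor$, $$\mathbb E_{\mathcal R_2}[f(\mathcal R_2)]\ \ge\ s^{(\mu)}\Big[1-\sqrt{\tfrac{\beta}{2\pi(1+\beta)\lfloor(1+\beta)\mu\rfloor}}\Big(2\sqrt{\tfrac1{1+\beta}}+\sqrt{1-\beta}\Big)-\frac{1+2\beta}{(1+\beta)\lceil\beta\mu\rceil}\,\epsilon\Big]\Big[1-\frac{\epsilon}{\lceil(1+\beta)\mu\rceil}\Big].$$ -/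

import Mathlib

open scoped BigOperators

namespace TwoStage

noncomputable section

/-- The set `M(R', P'; ℓrev, ℓpap)` of valid assignments of the reviewers in `R'` to the papers in
`P'`: 0/1 matrices supported on `R' × P'` in which every paper of `P'` has `ℓpap` reviewers (between
`⌊ℓpap⌋` and `⌈ℓpap⌉` reviewers if `ℓpap` is not an integer) and every reviewer of `R'` has at
most `ℓrev` papers. -/
def validAssignments {nR n : ℕ} (R' : Finset (Fin nR)) (P' : Finset (Fin n))
    (ℓrev : ℕ) (ℓpap : ℝ) : Set (Matrix (Fin nR) (Fin n) ℕ) :=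
  {A | (∀ r p, A r p = 0 ∨ A r p = 1) ∧
    (∀ p ∈ P', ⌊ℓpap⌋₊ ≤ ∑ r ∈ R', A r p ∧ ∑ r ∈ R', A r p ≤ ⌈ℓpap⌉₊) ∧
    (∀ r ∈ R', ∑ p ∈ P', A r p ≤ ℓrev) ∧
    (∀ r p, ¬ (r ∈ R' ∧ p ∈ P') → A r p = 0)}

/-- For an integral paper load the two-sided condition is an equality. -/
theorem mem_validAssignments_natCast {nR n : ℕ} (R' : Finset (Fin nR)) (P' : Finset (Fin n))
    (ℓrev ℓpap : ℕ) (A : Matrix (Fin nR) (Fin n) ℕ) :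
    A ∈ validAssignments R' P' ℓrev (ℓpap : ℝ) ↔
      (∀ r p, A r p = 0 ∨ A r p = 1) ∧ (∀ p ∈ P', ∑ r ∈ R', A r p = ℓpap) ∧
      (∀ r ∈ R', ∑ p ∈ P', A r p ≤ ℓrev) ∧ (∀ r p, ¬ (r ∈ R' ∧ p ∈ P') → A r p = 0) := by
  simp only [validAssignments, Set.mem_ofPred_eq, Nat.floor_natCast, Nat.ceil_natCast]
  have h : ∀ p, (ℓpap ≤ ∑ r ∈ R', A r p ∧ ∑ r ∈ R', A r p ≤ ℓpap) ↔
      ∑ r ∈ R', A r p = ℓpap := fun p => by omega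
  simp only [h]

/-- Total similarity `∑ A_{rp} S_{rp}` of an assignment. -/
def totalSim {nR n : ℕ} (S : Matrix (Fin nR) (Fin n) ℝ) (A : Matrix (Fin nR) (Fin n) ℕ) : ℝ :=
  ∑ r, ∑ p, (A r p : ℝ) * S r p

/-- Mean similarity, `∑ A_{rp} S_{rp} / (ℓpap * n)`, of an assignment of all `n` papers with
paper load `ℓpap`. -/
def meanSim {nR n : ℕ} (S : Matrix (Fin nR) (Fin n) ℝ) (ℓpap : ℝ)
    (A : Matrix (Fin nR) (Fin n) ℕ) : ℝ :=
  totalSim S A / (ℓpap * n)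

/-- The maximum total similarity over `M(R', P'; 1, 1)`. -/
def maxSim {nR n : ℕ} (S : Matrix (Fin nR) (Fin n) ℝ)
    (R' : Finset (Fin nR)) (P' : Finset (Fin n)) : ℝ :=
  sSup (totalSim S '' validAssignments R' P' 1 1)

/-- `Q(R₂, P₂)`: mean similarity of the optimal assignment, all loads being one, when the reviewers
`R₂` and the papers `P₂` are in the second stage. -/
def Q {nR n : ℕ} (S : Matrix (Fin nR) (Fin n) ℝ)
    (R₂ : Finset (Fin nR)) (P₂ : Finset (Fin n)) : ℝ :=
  (maxSim S R₂ᶜ Finset.univ + maxSim S R₂ P₂) / ((n : ℝ) + (P₂.card : ℝ))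

/-- `f(R₂)`: the expectation of `Q(R₂, P₂)` when `P₂` is uniform over the sets of `k` papers. -/
def f {nR n : ℕ} (S : Matrix (Fin nR) (Fin n) ℝ) (k : ℕ) (R₂ : Finset (Fin nR)) : ℝ :=
  𝔼 P₂ ∈ Finset.powersetCard k (Finset.univ : Finset (Fin n)), Q S R₂ P₂

/-- Expected value of random split: the expectation of `f(R₂)` when `R₂` is uniform over the sets
of `m` reviewers. -/
def randomSplitValue {nR n : ℕ} (S : Matrix (Fin nR) (Fin n) ℝ) (k m : ℕ) : ℝ :=
  𝔼 R₂ ∈ Finset.powersetCard m (Finset.univ : Finset (Fin nR)), f S k R₂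

/-- The supremum in `maxSim` is a maximum whenever the assignment problem is feasible. -/
theorem isGreatest_maxSim {nR n : ℕ} (S : Matrix (Fin nR) (Fin n) ℝ)
    (R' : Finset (Fin nR)) (P' : Finset (Fin n)) (h : R'.card ≥ P'.card) :
    IsGreatest (totalSim S '' validAssignments R' P' 1 1) (maxSim S R' P') := by
  have hfin : (validAssignments R' P' 1 1 : Set (Matrix (Fin nR) (Fin n) ℕ)).Finite := by
    apply Set.Finite.subset (Set.Finite.pi' (t := fun _ : Fin nR =>
      {g : Fin n → ℕ | ∀ p, g p ∈ Set.Iic 1}) fun _ => Set.Finite.pi' fun _ => Set.finite_Iic 1)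
    intro A hA r p
    rcases hA.1 r p with h | h <;> simp [h]
  have hne : (validAssignments R' P' 1 1 : Set (Matrix (Fin nR) (Fin n) ℕ)).Nonempty := by
    obtain ⟨e⟩ : Nonempty (P' ↪ R') :=
      Function.Embedding.nonempty_of_card_le (by simpa using h)
    refine ⟨fun r p => if ∃ hp : p ∈ P', (e ⟨p, hp⟩ : Fin nR) = r then 1 else 0, ?_⟩
    have := (mem_validAssignments_natCast R' P' 1 1
      (fun r p => if ∃ hp : p ∈ P', (e ⟨p, hp⟩ : Fin nR) = r then 1 else 0)).2 ?_
    · simpa using this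
    refine ⟨fun r p => by split_ifs <;> simp, ?_, ?_, ?_⟩
    · intro p hp
      simp only [hp, exists_true_left]
      rw [Finset.sum_ite_eq]
      simp
    · intro r _
      rw [Finset.sum_boole, Nat.cast_id, Finset.card_le_one]
      intro a ha b hb
      simp only [Finset.mem_filter] at ha hb
      obtain ⟨_, ha', ha⟩ := ha
      obtain ⟨_, hb', hb⟩ := hb
      have := e.injective (Subtype.ext (ha.trans hb.symm))
      simpa using this
    · intro r p hrp
      rw [if_neg]
      rintro ⟨hp, rfl⟩
      exact hrp ⟨(e ⟨p, hp⟩).2, hp⟩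
  exact ((hne.image _).csSup_mem (hfin.image _)).elim fun A hA =>
    ⟨⟨A, hA⟩, fun x hx => le_csSup (hfin.image _).bddAbove hx⟩

end

end TwoStage

/-!
Drop edges from the given assignment `A` until every paper has exactly `t = ⌊(1 + β) μ⌋` reviewers;
dropping the least similar ones costs at most a factor `t / ⌈(1 + β) μ⌉`. For a split `(R₂, P₂)`
the surviving edges give fractional assignments for the two stages: an edge at the paper `p` gets
weight `1 / max μ X` in the first stage, and an edge at `(r, p)` gets `1 / max C Y Z` in the second,
where `X` and `Y` count the reviewers of `p` in the two groups, `Z` counts the papers of `r` in `P₂`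
and `C = ⌈β μ⌉`. By Birkhoff's theorem an optimal integral assignment is at least as good as any
fractional one (`sum_weight_le_maxSim`), similarities being nonnegative.

The edges at a vertex are exchangeable, so the expectation of a term that depends on one vertex is
its expected total at the vertex divided by the degree (`expect_mem_of_mem`). The expected weight
of an edge thus falls short of the ideal value only through expected excesses `𝔼 (X - k)⁺`, where
`X` is hypergeometric and `k` is an integer at least the mean of `X`. The excess is at most that
of a binomial variable of mean `k` (`expect_powersetCard_le_bernoulli`, Hoeffding's comparison of
sampling without and with replacement). For the binomial variable, De Moivre's formula
(`sum_binomial_mul_posPart_sub`) expresses the excess by the central binomial weight, and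
Stirling's formula bounds it by `√(t p (1 - p) / (2π))` (`binomial_posPart_le`).
The square roots in the theorem are three such excesses: one for the papers in each stage and one
for the reviewers in the second. If `β μ` is not an integer, the rounding is absorbed by the
summand with `ε` (`edge_weight_ge`).
-/

namespace TwoStage

/-! ### Uniform random subsets of fixed size -/

section Sampling
variable {α : Type*} [Fintype α] [DecidableEq α]

omit [DecidableEq α] in
theorem powersetCard_univ_nonempty {d : ℕ} (hd : d ≤ Fintype.card α) :
    (Finset.powersetCard d (Finset.univ : Finset α)).Nonempty :=
  Finset.powersetCard_nonempty.2 (by simpa using hd)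

omit [DecidableEq α] in
theorem expect_powersetCard_map (σ : Equiv.Perm α) (d : ℕ) (g : Finset α → ℝ) :
    𝔼 D ∈ Finset.powersetCard d Finset.univ, g (D.map σ.toEmbedding)
      = 𝔼 D ∈ Finset.powersetCard d (Finset.univ : Finset α), g D :=
  Finset.expect_equiv σ.finsetCongr (fun D => by simp [Finset.mem_powersetCard])
    (fun D _ => by simp)

theorem expect_powersetCard_compl {d d' : ℕ} (h : d + d' = Fintype.card α) (g : Finset α → ℝ) :
    𝔼 D ∈ Finset.powersetCard d Finset.univ, g Dᶜ
      = 𝔼 D ∈ Finset.powersetCard d' (Finset.univ : Finset α), g D := by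
  refine Finset.expect_nbij' compl compl ?_ ?_ ?_ ?_ ?_
  · intro D hD
    simp only [Finset.mem_powersetCard_univ, Finset.card_compl] at hD ⊢
    omega
  · intro D hD
    simp only [Finset.mem_powersetCard_univ, Finset.card_compl] at hD ⊢
    omega
  all_goals simp

theorem exists_perm_map_eq {A B : Finset α} (h : A.card = B.card) :
    ∃ τ : Equiv.Perm α, A.map τ.toEmbedding = B := by
  classical
  let e : {x // x ∈ A} ≃ {x // x ∈ B} := Finset.equivOfCardEq h
  refine ⟨e.extendSubtype, Finset.eq_of_subset_of_card_le ?_ (by simp [h])⟩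
  intro x hx
  obtain ⟨a, ha, rfl⟩ := Finset.mem_map.1 hx
  exact e.extendSubtype_mem a ha

/-- A uniformly random permutation takes a fixed set to a uniformly random set of the same size.
This couples random sets of different sizes. -/
theorem expect_perm_map {A : Finset α} (g : Finset α → ℝ) :
    𝔼 σ : Equiv.Perm α, g (A.map σ.toEmbedding)
      = 𝔼 D ∈ Finset.powersetCard A.card (Finset.univ : Finset α), g D := by
  have hconst : ∀ D ∈ Finset.powersetCard A.card (Finset.univ : Finset α),
      𝔼 σ : Equiv.Perm α, g (D.map σ.toEmbedding) =
        𝔼 σ : Equiv.Perm α, g (A.map σ.toEmbedding) := by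
    intro D hD
    obtain ⟨τ, rfl⟩ := exists_perm_map_eq (Finset.mem_powersetCard_univ.1 hD).symm
    refine Fintype.expect_equiv (Equiv.mulRight τ) _ _ fun σ => ?_
    rw [Finset.map_map]
    rfl
  have hne := powersetCard_univ_nonempty (α := α) (Finset.card_le_univ A)
  calc 𝔼 σ : Equiv.Perm α, g (A.map σ.toEmbedding)
      = 𝔼 D ∈ Finset.powersetCard A.card (Finset.univ : Finset α),
          𝔼 σ : Equiv.Perm α, g (D.map σ.toEmbedding) := by
        rw [Finset.expect_congr rfl hconst, Finset.expect_const hne]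
    _ = 𝔼 σ : Equiv.Perm α, 𝔼 D ∈ Finset.powersetCard A.card (Finset.univ : Finset α), g D := by
        rw [Finset.expect_comm]
        exact Finset.expect_congr rfl fun σ _ => expect_powersetCard_map σ _ g
    _ = _ := Fintype.expect_const _

/-- By symmetry all elements `e` of `T` contribute equally to `𝔼 |D ∩ T| ψ(|D ∩ T|)`. -/
theorem expect_mem_of_mem {T : Finset α} {e : α} (he : e ∈ T) (d : ℕ) (ψ : ℕ → ℝ) :
    𝔼 D ∈ Finset.powersetCard d (Finset.univ : Finset α), (if e ∈ D then ψ (D ∩ T).card else 0)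
      = (𝔼 D ∈ Finset.powersetCard d (Finset.univ : Finset α),
          ((D ∩ T).card : ℝ) * ψ (D ∩ T).card) / T.card := by
  have hconst : ∀ e' ∈ T,
      𝔼 D ∈ Finset.powersetCard d (Finset.univ : Finset α), (if e' ∈ D then ψ (D ∩ T).card else 0)
      = 𝔼 D ∈ Finset.powersetCard d (Finset.univ : Finset α),
        (if e ∈ D then ψ (D ∩ T).card else 0) := by
    intro e' he'
    rw [← expect_powersetCard_map (Equiv.swap e e')]
    refine Finset.expect_congr rfl fun D _ => ?_
    have hT : T.map (Equiv.swap e e').toEmbedding = T := by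
      refine Finset.eq_of_subset_of_card_le ?_ (by simp)
      intro x hx
      obtain ⟨a, ha, rfl⟩ := Finset.mem_map.1 hx
      simp only [Equiv.coe_toEmbedding, Equiv.swap_apply_def]
      split_ifs <;> assumption
    have h1 : (D.map (Equiv.swap e e').toEmbedding ∩ T).card = (D ∩ T).card := by
      conv_lhs => rw [← hT, ← Finset.map_inter, Finset.card_map]
    have h2 : e' ∈ D.map (Equiv.swap e e').toEmbedding ↔ e ∈ D := by
      rw [Finset.mem_map_equiv]; simp
    simp only [h1, h2]
  have hc : (T.card : ℝ) ≠ 0 := by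
    have := Finset.card_pos.2 ⟨e, he⟩
    positivity
  rw [eq_div_iff hc, mul_comm, ← nsmul_eq_mul, ← Finset.sum_const,
    ← Finset.sum_congr rfl hconst, ← Finset.expect_sum_comm]
  refine Finset.expect_congr rfl fun D _ => ?_
  rw [← Finset.sum_filter, Finset.sum_const, nsmul_eq_mul, Finset.filter_mem_eq_inter,
    Finset.inter_comm]

theorem expect_mem (e : α) {d : ℕ} (hd : d ≤ Fintype.card α) (c : ℝ) :
    𝔼 D ∈ Finset.powersetCard d (Finset.univ : Finset α), (if e ∈ D then c else 0)
      = (d : ℝ) / Fintype.card α * c := by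
  rw [expect_mem_of_mem (Finset.mem_univ e) d fun _ => c, Finset.card_univ]
  rw [Finset.expect_congr rfl (g := fun _ => (d : ℝ) * c),
    Finset.expect_const (powersetCard_univ_nonempty hd)]
  · ring
  · intro D hD
    rw [Finset.inter_univ, Finset.mem_powersetCard_univ.1 hD]

theorem expect_card_inter (T : Finset α) {d : ℕ} (hd : d ≤ Fintype.card α) :
    𝔼 D ∈ Finset.powersetCard d (Finset.univ : Finset α), ((D ∩ T).card : ℝ)
      = T.card * ((d : ℝ) / Fintype.card α) := by
  calc _ = 𝔼 D ∈ Finset.powersetCard d (Finset.univ : Finset α),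
          ∑ e ∈ T, (if e ∈ D then (1 : ℝ) else 0) := by
        refine Finset.expect_congr rfl fun D _ => ?_
        rw [← Finset.sum_filter, Finset.sum_const, Finset.filter_mem_eq_inter, Finset.inter_comm]
        simp
    _ = _ := by
        rw [Finset.expect_sum_comm, Finset.sum_congr rfl fun e _ => expect_mem e hd 1]
        simp

theorem expect_powersetCard_mono {g : Finset α → ℝ} (hmono : ∀ D x, g D ≤ g (insert x D)) {j : ℕ}
    (hj : j + 1 ≤ Fintype.card α) :
    𝔼 D ∈ Finset.powersetCard j (Finset.univ : Finset α), g D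
      ≤ 𝔼 D ∈ Finset.powersetCard (j + 1) (Finset.univ : Finset α), g D := by
  obtain ⟨B, hB⟩ := powersetCard_univ_nonempty (α := α) hj
  rw [Finset.mem_powersetCard_univ] at hB
  obtain ⟨x, A, hx, rfl, hA⟩ := Finset.card_eq_succ.1 hB
  rw [← hB, ← hA, ← expect_perm_map g, ← expect_perm_map g]
  refine Finset.expect_le_expect fun σ _ => ?_
  rw [Finset.map_insert]
  exact hmono _ _

/-- The mean of a supermodular function over the `j`-element sets is a convex function of `j`. -/
theorem expect_powersetCard_convex {g : Finset α → ℝ}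
    (hsup : ∀ D x y, x ≠ y → x ∉ D → y ∉ D →
      g (insert x D) + g (insert y D) ≤ g D + g (insert x (insert y D)))
    {j : ℕ} (hj : j + 2 ≤ Fintype.card α) :
    2 * 𝔼 D ∈ Finset.powersetCard (j + 1) (Finset.univ : Finset α), g D
      ≤ (𝔼 D ∈ Finset.powersetCard j (Finset.univ : Finset α), g D)
        + 𝔼 D ∈ Finset.powersetCard (j + 2) (Finset.univ : Finset α), g D := by
  obtain ⟨B, hB⟩ := powersetCard_univ_nonempty (α := α) hj
  rw [Finset.mem_powersetCard_univ] at hB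
  obtain ⟨x, B', hx, rfl, hB'⟩ := Finset.card_eq_succ.1 hB
  obtain ⟨y, A, hy, rfl, hA⟩ := Finset.card_eq_succ.1 hB'
  rw [Finset.mem_insert, not_or] at hx
  have hxA : (insert x A).card = j + 1 := by rw [Finset.card_insert_of_notMem hx.2, hA]
  rw [two_mul]
  nth_rw 1 [← hxA]
  rw [← hB, ← hB', ← hA, ← expect_perm_map g, ← expect_perm_map g, ← expect_perm_map g,
    ← expect_perm_map g, ← Finset.expect_add_distrib, ← Finset.expect_add_distrib]
  refine Finset.expect_le_expect fun σ _ => ?_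
  simp only [Finset.map_insert]
  exact hsup _ _ _ (by simpa using hx.1) (by simpa using hx.2) (by simpa using hy)

end Sampling

/-- A nondecreasing convex sequence on `{0, …, N}` has a supporting line of nonnegative slope at
`d`. -/
theorem exists_supporting_line {u : ℕ → ℝ} {N : ℕ} (hmono : ∀ j, j + 1 ≤ N → u j ≤ u (j + 1))
    (hconv : ∀ j, j + 2 ≤ N → 2 * u (j + 1) ≤ u j + u (j + 2)) {d : ℕ} (hd : d ≤ N) :
    ∃ s : ℝ, 0 ≤ s ∧ ∀ j ≤ N, u d + s * ((j : ℝ) - d) ≤ u j := by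
  -- The slope is the backward difference at `d`, or `0` at the left end, where there is none.
  rcases d with _ | e
  · refine ⟨0, le_rfl, fun j => ?_⟩
    induction j with
    | zero => simp
    | succ j ih => intro hj; have := ih (by omega); have := hmono j hj; linarith
  · have hdiff : ∀ a b, a ≤ b → b + 1 ≤ N → u (a + 1) - u a ≤ u (b + 1) - u b := by
      intro a b hab
      induction b, hab using Nat.le_induction with
      | base => intro _; exact le_rfl
      | succ b _ ih => intro hb; have := ih (by omega); have := hconv b hb; linarith
    refine ⟨u (e + 1) - u e, sub_nonneg.2 (hmono e hd), fun j hj => ?_⟩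
    rcases le_total (e + 1) j with h | h
    · induction j, h using Nat.le_induction with
      | base => simp
      | succ j h ih =>
        have h1 := ih (by omega)
        have h2 := hdiff e j (by omega) hj
        push_cast at h1 ⊢
        linarith
    · induction h using Nat.decreasingInduction with
      | self => simp
      | of_succ j h ih =>
        have h1 := ih (by omega)
        have h2 := hdiff j e (by omega) hd
        push_cast at h1 ⊢
        linarith

theorem sum_bernstein_weights (N : ℕ) (p : ℝ) :
    ∑ j ∈ Finset.range (N + 1), (N.choose j : ℝ) * (p ^ j * (1 - p) ^ (N - j)) = 1 := by
  have := congrArg (Polynomial.eval p) (bernsteinPolynomial.sum ℝ N)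
  simpa [Polynomial.eval_finsetSum, bernsteinPolynomial, mul_assoc] using this

theorem sum_bernstein_weights_mul (N : ℕ) (p : ℝ) :
    ∑ j ∈ Finset.range (N + 1), (N.choose j : ℝ) * (p ^ j * (1 - p) ^ (N - j)) * j = N * p := by
  have := congrArg (Polynomial.eval p) (bernsteinPolynomial.sum_smul ℝ N)
  simp only [Polynomial.eval_finsetSum, bernsteinPolynomial, nsmul_eq_mul, Polynomial.eval_mul,
    Polynomial.eval_natCast, Polynomial.eval_pow, Polynomial.eval_X, Polynomial.eval_sub,
    Polynomial.eval_one] at this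
  rw [← this]
  exact Finset.sum_congr rfl fun j _ => by ring

section Sampling
variable {α : Type*} [Fintype α] [DecidableEq α]

/-- Hoeffding's comparison: for a monotone supermodular `g`, a uniform `d`-element set does at most
as well as a set containing each element independently with probability `p ≥ d / |α|`. Given its
size, the Bernoulli set is uniform, and the mean over `j`-element sets is convex in `j`, so that
this is Jensen's inequality. -/
theorem expect_powersetCard_le_bernoulli {g : Finset α → ℝ} (hmono : ∀ D x, g D ≤ g (insert x D))
    (hsup : ∀ D x y, x ≠ y → x ∉ D → y ∉ D →
      g (insert x D) + g (insert y D) ≤ g D + g (insert x (insert y D)))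
    {d : ℕ} (hd : d ≤ Fintype.card α) {p : ℝ} (hp0 : 0 ≤ p) (hp1 : p ≤ 1)
    (hdp : (d : ℝ) ≤ Fintype.card α * p) :
    𝔼 D ∈ Finset.powersetCard d (Finset.univ : Finset α), g D
      ≤ ∑ D ∈ (Finset.univ : Finset α).powerset,
          p ^ D.card * (1 - p) ^ ((Finset.univ : Finset α).card - D.card) * g D := by
  set N := Fintype.card α with hN
  set u : ℕ → ℝ := fun j => 𝔼 D ∈ Finset.powersetCard j (Finset.univ : Finset α), g D with hu
  obtain ⟨s, hs, hline⟩ := exists_supporting_line (u := u) (N := N)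
    (fun j hj => expect_powersetCard_mono hmono hj)
    (fun j hj => expect_powersetCard_convex hsup hj) hd
  have hsum : ∑ D ∈ (Finset.univ : Finset α).powerset,
          p ^ D.card * (1 - p) ^ ((Finset.univ : Finset α).card - D.card) * g D
      = ∑ j ∈ Finset.range (N + 1), (N.choose j : ℝ) * (p ^ j * (1 - p) ^ (N - j)) * u j := by
    rw [Finset.sum_powerset, Finset.card_univ]
    refine Finset.sum_congr rfl fun j _ => ?_
    have h1 := Finset.card_mul_expect (Finset.powersetCard j (Finset.univ : Finset α)) g
    rw [Finset.card_powersetCard, Finset.card_univ] at h1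
    rw [mul_right_comm, h1, Finset.sum_mul]
    refine Finset.sum_congr rfl fun D hD => ?_
    rw [Finset.mem_powersetCard_univ.1 hD, mul_comm]
  rw [hsum]
  calc u d ≤ u d + s * (N * p - d) := by
        have := mul_nonneg hs (sub_nonneg.2 hdp); linarith
    _ = ∑ j ∈ Finset.range (N + 1), (N.choose j : ℝ) * (p ^ j * (1 - p) ^ (N - j)) *
          (u d + s * ((j : ℝ) - d)) := by
        have e1 := sum_bernstein_weights N p
        have e2 := sum_bernstein_weights_mul N p
        have : ∀ j : ℕ, (N.choose j : ℝ) * (p ^ j * (1 - p) ^ (N - j)) * (u d + s * ((j : ℝ) - d))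
            = (N.choose j : ℝ) * (p ^ j * (1 - p) ^ (N - j)) * (u d - s * d) +
              (N.choose j : ℝ) * (p ^ j * (1 - p) ^ (N - j)) * j * s := fun j => by ring
        simp only [this, Finset.sum_add_distrib, ← Finset.sum_mul, e1, e2]
        ring
    _ ≤ _ := by
        refine Finset.sum_le_sum fun j hj => mul_le_mul_of_nonneg_left
          (hline j (Nat.lt_succ_iff.1 (Finset.mem_range.1 hj))) ?_
        have : 0 ≤ 1 - p := by linarith
        positivity

omit [Fintype α] in
/-- The trace on `T` of a Bernoulli random subset of `U` is a Bernoulli random subset of `T`. -/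
theorem sum_bernoulli_inter (p q : ℝ) (hpq : p + q = 1) (T : Finset α) (φ : ℕ → ℝ) :
    ∀ U : Finset α, T ⊆ U → ∑ D ∈ U.powerset, p ^ D.card * q ^ (U.card - D.card) * φ (D ∩ T).card
      = ∑ D ∈ T.powerset, p ^ D.card * q ^ (T.card - D.card) * φ D.card := by
  intro U hTU
  induction hn : (U \ T).card generalizing U with
  | zero =>
    have : U = T := Finset.Subset.antisymm
      (Finset.sdiff_eq_empty_iff_subset.1 (Finset.card_eq_zero.1 hn)) hTU
    subst this
    refine Finset.sum_congr rfl fun D hD => ?_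
    rw [Finset.inter_eq_left.2 (Finset.mem_powerset.1 hD)]
  | succ n ih =>
    obtain ⟨x, hx⟩ := Finset.card_pos.1 (by omega : 0 < (U \ T).card)
    rw [Finset.mem_sdiff] at hx
    have hTV : T ⊆ U.erase x := Finset.subset_erase.2 ⟨hTU, hx.2⟩
    have hcard : (U.erase x \ T).card = n := by
      rw [Finset.erase_sdiff_comm, Finset.card_erase_of_mem (Finset.mem_sdiff.2 hx), hn]; rfl
    rw [← ih _ hTV hcard]
    conv_lhs => rw [← Finset.insert_erase hx.1]
    rw [Finset.sum_powerset_insert (Finset.notMem_erase x U), ← Finset.sum_add_distrib]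
    refine Finset.sum_congr rfl fun D hD => ?_
    have hDU := Finset.mem_powerset.1 hD
    have hxD : x ∉ D := fun h => Finset.notMem_erase x U (hDU h)
    rw [Finset.card_insert_of_notMem (Finset.notMem_erase x U), Finset.card_insert_of_notMem hxD,
      Finset.insert_inter_of_notMem hx.2]
    have := Finset.card_le_card hDU
    rw [Nat.add_sub_add_right, Nat.succ_sub this, pow_succ, pow_succ]
    linear_combination (p ^ D.card * q ^ ((U.erase x).card - D.card) * φ (D ∩ T).card) * hpq

/-- The expected excess over `k` of the hypergeometric variable `|D ∩ T|` is at most that of a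
binomial variable whose mean is no smaller. -/
theorem expect_posPart_le_binomial (T : Finset α) (k : ℕ) {d : ℕ} (hd : d ≤ Fintype.card α)
    {p : ℝ} (hp0 : 0 ≤ p) (hp1 : p ≤ 1) (hdp : (d : ℝ) ≤ Fintype.card α * p) :
    𝔼 D ∈ Finset.powersetCard d (Finset.univ : Finset α), max 0 (((D ∩ T).card : ℝ) - k)
      ≤ ∑ x ∈ Finset.range (T.card + 1), (T.card.choose x : ℝ) *
          (p ^ x * (1 - p) ^ (T.card - x) * max 0 ((x : ℝ) - k)) := by
  refine (expect_powersetCard_le_bernoulli ?_ ?_ hd hp0 hp1 hdp).trans_eq ?_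
  · intro D x
    have : ((D ∩ T).card : ℝ) ≤ ((insert x D ∩ T).card : ℝ) := by
      exact_mod_cast Finset.card_le_card
        (Finset.inter_subset_inter_right (Finset.subset_insert x D))
    gcongr
  · intro D x y hxy hx hy
    -- Convexity of the positive part, the only case in which both elements count.
    have key : ∀ c : ℕ, max (0 : ℝ) ((c + 1 : ℕ) - k) + max (0 : ℝ) ((c + 1 : ℕ) - k)
        ≤ max (0 : ℝ) ((c : ℝ) - k) + max (0 : ℝ) ((c + 1 + 1 : ℕ) - k) := by
      intro c
      push_cast
      rcases lt_trichotomy c k with h | h | h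
      · have : (c : ℝ) + 1 ≤ k := by exact_mod_cast h
        rw [max_eq_left (by linarith : (c : ℝ) + 1 - k ≤ 0)]
        have := le_max_left 0 ((c : ℝ) - k)
        have := le_max_left 0 ((c : ℝ) + 1 + 1 - k)
        linarith
      · subst h
        rw [show (c : ℝ) + 1 - c = 1 by ring, show (c : ℝ) + 1 + 1 - c = 2 by ring]
        norm_num
      · have : (k : ℝ) + 1 ≤ c := by exact_mod_cast h
        rw [max_eq_right (by linarith), max_eq_right (by linarith), max_eq_right (by linarith)]
        linarith
    have hx' : x ∉ insert y D := by simp [hxy, hx]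
    by_cases hxT : x ∈ T <;> by_cases hyT : y ∈ T
    · rw [Finset.insert_inter_of_mem hxT, Finset.insert_inter_of_mem hyT,
        Finset.insert_inter_of_mem hxT, Finset.insert_inter_of_mem hyT,
        Finset.card_insert_of_notMem (by simp [hx]), Finset.card_insert_of_notMem (by simp [hy]),
        Finset.card_insert_of_notMem (by simp [hxy, hx]),
        Finset.card_insert_of_notMem (by simp [hy])]
      exact key _
    · rw [Finset.insert_inter_of_notMem hyT, Finset.insert_inter_of_mem hxT,
        Finset.insert_inter_of_mem hxT, Finset.insert_inter_of_notMem hyT, add_comm]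
    · rw [Finset.insert_inter_of_notMem hxT, Finset.insert_inter_of_notMem hxT]
    · rw [Finset.insert_inter_of_notMem hxT, Finset.insert_inter_of_notMem hxT]
  · rw [sum_bernoulli_inter p (1 - p) (by ring) T (fun c => max 0 ((c : ℝ) - k)) _
      (Finset.subset_univ T), Finset.sum_powerset_apply_card
        (fun c => p ^ c * (1 - p) ^ (T.card - c) * max 0 ((c : ℝ) - k))]
    simp
end Sampling

/-! ### Expected excess over the mean -/

/-- De Moivre's formula for the expected excess `𝔼 (X - k)⁺` of a binomial variable of integral
mean `k`. -/
theorem sum_binomial_mul_posPart_sub (t k : ℕ) (p q : ℝ) (hpq : p + q = 1)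
    (hk : t * p = k) :
    ∑ x ∈ Finset.range (t + 1), (t.choose x : ℝ) * (p ^ x * q ^ (t - x) * max 0 ((x : ℝ) - k))
      = k * q * (t.choose k * p ^ k * q ^ (t - k)) := by
  set G : ℕ → ℝ := fun x => x * q * (t.choose x * p ^ x * q ^ (t - x)) with hG
  -- The terms `P(X = x) (x - k)` telescope.
  have hstep : ∀ x, x ≤ t →
      (t.choose x : ℝ) * (p ^ x * q ^ (t - x)) * ((x : ℝ) - k) = G x - G (x + 1) := by
    intro x hx
    have hch : ((t.choose (x + 1) : ℕ) : ℝ) * (x + 1) = t.choose x * ((t : ℝ) - x) := by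
      have := Nat.choose_succ_right_eq t x
      rw [← Nat.cast_sub hx]
      exact_mod_cast this
    have hq : q * ((t.choose (x + 1) : ℝ) * q ^ (t - (x + 1)))
        = (t.choose (x + 1) : ℝ) * q ^ (t - x) := by
      rcases hx.lt_or_eq with h | h
      · rw [show t - x = t - (x + 1) + 1 by omega]; ring
      · simp [h]
    have h2 : G (x + 1) = t.choose x * ((t : ℝ) - x) * p ^ (x + 1) * q ^ (t - x) := by
      simp only [hG]; push_cast
      linear_combination (((x : ℝ) + 1) * p ^ (x + 1)) * hq + p ^ (x + 1) * q ^ (t - x) * hch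
    rw [h2, ← hk]; simp only [hG]
    have : q = 1 - p := by linarith
    rw [pow_succ]
    generalize q ^ (t - x) = y
    rw [this]; ring
  have key : ∀ j, k ≤ j → j ≤ t + 1 →
      ∑ x ∈ Finset.range j, (t.choose x : ℝ) * (p ^ x * q ^ (t - x) * max 0 ((x : ℝ) - k))
        = G k - G j := by
    intro j hkj
    induction j, hkj using Nat.le_induction with
    | base =>
      intro _
      rw [sub_self]
      refine Finset.sum_eq_zero fun x hx => ?_
      have : (x : ℝ) < k := by exact_mod_cast Finset.mem_range.1 hx
      rw [max_eq_left (by linarith)]; ring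
    | succ j hkj ih =>
      intro hj
      have : (k : ℝ) ≤ j := by exact_mod_cast hkj
      rw [Finset.sum_range_succ, ih (by omega), max_eq_right (by linarith), ← mul_assoc,
        hstep j (by omega)]
      ring
  by_cases hkt : k ≤ t + 1
  · rw [key (t + 1) hkt le_rfl]
    simp [hG]
  · rw [Nat.choose_eq_zero_of_lt (by omega)]
    simp only [Nat.cast_zero, zero_mul, mul_zero]
    refine Finset.sum_eq_zero fun x hx => ?_
    have : (x : ℝ) < k := by
      have := Finset.mem_range.1 hx
      exact_mod_cast (by omega : x < k)
    rw [max_eq_left (by linarith)]; ring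

theorem factorial_eq_stirlingSeq {n : ℕ} (hn : n ≠ 0) :
    (n.factorial : ℝ) = Stirling.stirlingSeq n * √(2 * n) * ((n : ℝ) / Real.exp 1) ^ n := by
  rw [Stirling.stirlingSeq, mul_assoc, div_mul_cancel₀]
  have : (0 : ℝ) < n := by positivity
  positivity

/-- A binomial variable of integral mean takes that value with probability at most
`1 / √(2π Var)`: the Stirling sequence decreases, and is bounded below by `√π`. -/
theorem choose_mul_pow_mul_pow_le {t k : ℕ} (hk : 0 < k) (hkt : k < t) :
    (t.choose k : ℝ) * ((k : ℝ) / t) ^ k * (((t : ℝ) - k) / t) ^ (t - k)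
      ≤ √(t / (2 * Real.pi * k * ((t : ℝ) - k))) := by
  obtain ⟨j, rfl⟩ := Nat.exists_eq_add_of_lt hkt
  obtain ⟨i, rfl⟩ := Nat.exists_eq_succ_of_ne_zero hk.ne'
  set k := i.succ with hkdef
  set l := j + 1 with hl
  have e : k + j + 1 = k + l := by omega
  rw [e, Nat.add_sub_cancel_left, Nat.cast_add_choose]
  have hk' : (0 : ℝ) < k := by positivity
  have hl' : (0 : ℝ) < l := by positivity
  rw [factorial_eq_stirlingSeq (n := k) (by omega), factorial_eq_stirlingSeq (n := l) (by omega),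
    factorial_eq_stirlingSeq (n := k + l) (by omega)]
  have h1 : Stirling.stirlingSeq (k + l) ≤ Stirling.stirlingSeq k := by
    have := Stirling.stirlingSeq'_antitone (show i ≤ i + l by omega)
    simp only [Function.comp] at this
    rwa [show (i + l).succ = k + l by omega] at this
  have h2 : √Real.pi ≤ Stirling.stirlingSeq l := Stirling.sqrt_pi_le_stirlingSeq (by omega)
  have h0 : 0 < Stirling.stirlingSeq k := by
    have := Stirling.sqrt_pi_le_stirlingSeq (n := k) (by omega)
    have : 0 < √Real.pi := by positivity
    linarith
  push_cast
  set A := Stirling.stirlingSeq (k + l)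
  set B := Stirling.stirlingSeq k
  set D := Stirling.stirlingSeq l
  have hpi : 0 < √Real.pi := by positivity
  have hD : 0 < D := hpi.trans_le h2
  have heq : A * √(2 * ((k : ℝ) + l)) * (((k : ℝ) + l) / Real.exp 1) ^ (k + l) /
      (B * √(2 * k) * ((k : ℝ) / Real.exp 1) ^ k * (D * √(2 * l) * ((l : ℝ) / Real.exp 1) ^ l)) *
      ((k : ℝ) / (k + l)) ^ k * (((k : ℝ) + l - k) / (k + l)) ^ l
      = (A / (B * D)) * (√(2 * ((k : ℝ) + l)) / (√(2 * k) * √(2 * l))) := by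
    rw [show (k : ℝ) + l - k = l by ring]
    simp only [div_pow, pow_add]
    field_simp
  rw [heq]
  have h3 : A / (B * D) ≤ 1 / √Real.pi := by
    rw [div_le_div_iff₀ (by positivity) hpi]
    nlinarith
  refine (mul_le_mul_of_nonneg_right h3 (by positivity)).trans (le_of_eq ?_)
  rw [← Real.sqrt_mul (by positivity), ← Real.sqrt_div (by positivity), ← Real.sqrt_one,
    ← Real.sqrt_div (by positivity), ← Real.sqrt_mul (by positivity)]
  congr 1
  rw [show (k : ℝ) + l - k = l by ring]
  field_simp

/-- The expected excess of a binomial variable over its mean, if that is an integer, is at most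
`√(Var / (2π))`. -/
theorem binomial_posPart_le {t k : ℕ} (ht : 0 < t) (hkt : k ≤ t) :
    ∑ x ∈ Finset.range (t + 1), (t.choose x : ℝ) *
      (((k : ℝ) / t) ^ x * (1 - (k : ℝ) / t) ^ (t - x) * max 0 ((x : ℝ) - k))
      ≤ √(k * ((t : ℝ) - k) / (2 * Real.pi * t)) := by
  have ht' : (0 : ℝ) < t := by exact_mod_cast ht
  rw [sum_binomial_mul_posPart_sub t k _ _ (by ring) (by field_simp)]
  rcases Nat.eq_zero_or_pos k with h0 | h0
  · simp [h0]
  rcases hkt.eq_or_lt with h1 | h1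
  · subst h1
    simp [ht'.ne']
  have hk' : (0 : ℝ) < k := by exact_mod_cast h0
  have hl' : (0 : ℝ) < (t : ℝ) - k := by
    have : (k : ℝ) < t := by exact_mod_cast h1
    linarith
  have := choose_mul_pow_mul_pow_le h0 h1
  rw [show 1 - (k : ℝ) / t = ((t : ℝ) - k) / t by field_simp]
  refine (mul_le_mul_of_nonneg_left this (by positivity)).trans (le_of_eq ?_)
  rw [← Real.sqrt_sq (show 0 ≤ (k : ℝ) * (((t : ℝ) - k) / t) by positivity),
    ← Real.sqrt_mul (by positivity)]
  congr 1
  field_simp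

/-- If the mean `|T| d / |α|` of the hypergeometric variable `|D ∩ T|` is at most `k`, its expected
excess over `k` is bounded as for a binomial variable of mean `k`. -/
theorem expect_posPart_le {α : Type*} [Fintype α] [DecidableEq α] {T : Finset α} {k d : ℕ}
    (hkT : k ≤ T.card) (hd : d ≤ Fintype.card α)
    (hmean : T.card * d ≤ Fintype.card α * k) :
    𝔼 D ∈ Finset.powersetCard d (Finset.univ : Finset α), max 0 (((D ∩ T).card : ℝ) - k)
      ≤ √(k * ((T.card : ℝ) - k) / (2 * Real.pi * T.card)) := by
  rcases Nat.eq_zero_or_pos T.card with h0 | h0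
  · have hT : T = ∅ := Finset.card_eq_zero.1 h0
    subst hT
    rw [Finset.expect_eq_zero]
    · positivity
    · intro D _; simp
  have h0' : (0 : ℝ) < T.card := by exact_mod_cast h0
  have hk' : (k : ℝ) ≤ T.card := by exact_mod_cast hkT
  refine (expect_posPart_le_binomial T k hd (p := k / T.card) (by positivity)
    ((div_le_one h0').2 hk') ?_).trans (binomial_posPart_le h0 hkT)
  rw [mul_div_assoc', le_div_iff₀ h0', mul_comm]
  exact_mod_cast hmean

/-! ### Fractional assignments -/

theorem maxSim_nonneg {nR n : ℕ} {S : Matrix (Fin nR) (Fin n) ℝ} (hS : ∀ r p, 0 ≤ S r p)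
    (R' : Finset (Fin nR)) (P' : Finset (Fin n)) : 0 ≤ maxSim S R' P' := by
  refine Real.sSup_nonneg ?_
  rintro _ ⟨A, -, rfl⟩
  exact Finset.sum_nonneg fun r _ => Finset.sum_nonneg fun p _ =>
    mul_nonneg (Nat.cast_nonneg _) (hS r p)

/-- Every injective assignment of the papers competes in `maxSim`. -/
theorem sum_embedding_le_maxSim {nR n : ℕ} (S : Matrix (Fin nR) (Fin n) ℝ)
    {R' : Finset (Fin nR)} {P' : Finset (Fin n)} (e : P' ↪ R') :
    ∑ p : P', S (e p) p ≤ maxSim S R' P' := by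
  have hcard : P'.card ≤ R'.card := by
    simpa using Fintype.card_le_of_embedding e
  refine (isGreatest_maxSim S R' P' hcard).2
    ⟨Matrix.of fun r p => if ∃ hp : p ∈ P', (e ⟨p, hp⟩ : Fin nR) = r then 1 else 0, ?_, ?_⟩
  · rw [show (1 : ℝ) = ((1 : ℕ) : ℝ) by simp, mem_validAssignments_natCast]
    simp only [Matrix.of_apply]
    refine ⟨fun r p => by split_ifs <;> simp, ?_, ?_, ?_⟩
    · intro p hp
      simp only [hp, exists_true_left]
      rw [Finset.sum_ite_eq]
      simp
    · intro r _
      rw [Finset.sum_boole, Nat.cast_id, Finset.card_le_one]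
      intro a ha b hb
      simp only [Finset.mem_filter] at ha hb
      obtain ⟨_, ha', ha⟩ := ha
      obtain ⟨_, hb', hb⟩ := hb
      have := e.injective (Subtype.ext (ha.trans hb.symm))
      simpa using this
    · intro r p hrp
      rw [if_neg]
      rintro ⟨hp, rfl⟩
      exact hrp ⟨(e ⟨p, hp⟩).2, hp⟩
  · simp only [totalSim, Matrix.of_apply]
    rw [Finset.sum_comm, ← Finset.sum_subset (Finset.subset_univ P'),
      ← Finset.sum_attach P', Finset.univ_eq_attach]
    · refine Finset.sum_congr rfl fun p _ => ?_
      simp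
    · intro p _ hp
      simp [hp]

/-- A doubly substochastic matrix is dominated by a doubly stochastic one: fill in the product of
the row and column deficits, normalized by their common total. -/
theorem exists_doublyStochastic_ge {ι : Type*} [Fintype ι] [DecidableEq ι] (M : ι → ι → ℝ)
    (h0 : ∀ i j, 0 ≤ M i j) (hrow : ∀ i, ∑ j, M i j ≤ 1) (hcol : ∀ j, ∑ i, M i j ≤ 1) :
    ∃ M' ∈ doublyStochastic ℝ ι, ∀ i j, M i j ≤ M' i j := by
  set x : ι → ℝ := fun i => 1 - ∑ j, M i j with hx
  set y : ι → ℝ := fun j => 1 - ∑ i, M i j with hy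
  have hx0 : ∀ i, 0 ≤ x i := fun i => sub_nonneg.2 (hrow i)
  have hy0 : ∀ i, 0 ≤ y i := fun i => sub_nonneg.2 (hcol i)
  have hxy : ∑ i, x i = ∑ j, y j := by
    simp only [hx, hy, Finset.sum_sub_distrib]
    rw [Finset.sum_comm]
  have hτ : 0 ≤ ∑ i, x i := Finset.sum_nonneg fun i _ => hx0 i
  -- If no slack is left, the division by zero makes the correction vanish, as it should.
  have hxτ : ∀ i, x i * (∑ i, x i) / (∑ i, x i) = x i := by
    intro i
    by_cases h : ∑ i, x i = 0
    · rw [h, (Finset.sum_eq_zero_iff_of_nonneg fun i _ => hx0 i).1 h i (Finset.mem_univ i)]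
      simp
    · rw [mul_div_cancel_right₀ _ h]
  have hyτ : ∀ j, (∑ i, x i) * y j / (∑ i, x i) = y j := by
    intro j
    by_cases h : ∑ i, x i = 0
    · rw [h, (Finset.sum_eq_zero_iff_of_nonneg fun i _ => hy0 i).1 (hxy ▸ h) j (Finset.mem_univ j)]
      simp
    · rw [mul_div_cancel_left₀ _ h]
  refine ⟨Matrix.of fun i j => M i j + x i * y j / ∑ i, x i, ?_, fun i j => ?_⟩
  · rw [mem_doublyStochastic_iff_sum]
    simp only [Matrix.of_apply]
    refine ⟨fun i j => add_nonneg (h0 i j) (div_nonneg (mul_nonneg (hx0 i) (hy0 j)) hτ), ?_, ?_⟩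
    · intro i
      rw [Finset.sum_add_distrib, ← Finset.sum_div, ← Finset.mul_sum, ← hxy, hxτ]
      simp [hx]
    · intro j
      rw [Finset.sum_add_distrib, ← Finset.sum_div, ← Finset.sum_mul, hyτ]
      simp [hy]
  · have := div_nonneg (mul_nonneg (hx0 i) (hy0 j)) hτ
    simp only [Matrix.of_apply]
    linarith

/-- An optimal assignment is at least as good as any fractional assignment with unit loads, even one
that leaves papers partly unassigned. -/
theorem sum_weight_le_maxSim {nR n : ℕ} {S : Matrix (Fin nR) (Fin n) ℝ} (hS : ∀ r p, 0 ≤ S r p)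
    {R' : Finset (Fin nR)} {P' : Finset (Fin n)} (hcard : P'.card ≤ R'.card)
    (W : Fin nR → Fin n → ℝ) (hW : ∀ r p, 0 ≤ W r p)
    (hrow : ∀ r ∈ R', ∑ p ∈ P', W r p ≤ 1) (hcol : ∀ p ∈ P', ∑ r ∈ R', W r p ≤ 1) :
    ∑ r ∈ R', ∑ p ∈ P', W r p * S r p ≤ maxSim S R' P' := by
  obtain ⟨e⟩ : Nonempty (P' ↪ R') := Function.Embedding.nonempty_of_card_le (by simpa using hcard)
  -- Index the papers by their images in `R'`, so that the weights form a square matrix.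
  set ext : (R' → P' → ℝ) → R' → R' → ℝ := fun F r => Function.extend e (F r) 0 with hext
  have hexte : ∀ F r p, ext F r (e p) = F r p := fun F r p => e.injective.extend_apply _ _ _
  have hext0 : ∀ F r j, j ∉ Set.range e → ext F r j = 0 := fun F r j hj => by
    simp only [hext]
    rw [Function.extend_apply' _ _ _ (by simpa using hj)]; rfl
  set M := ext fun r p => W r p
  set S' := ext fun r p => S r p
  have hMe : ∀ r p, M r (e p) = W r p := fun r p => e.injective.extend_apply _ _ _
  have hSe : ∀ r p, S' r (e p) = S r p := fun r p => e.injective.extend_apply _ _ _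
  have hM0 : ∀ r j, j ∉ Set.range e → M r j = 0 := fun r j hj => hext0 (fun r p => W r p) r j hj
  have hS0 : ∀ r j, j ∉ Set.range e → S' r j = 0 := fun r j hj => hext0 (fun r p => S r p) r j hj
  have hext_nonneg : ∀ F : R' → P' → ℝ, (∀ r p, 0 ≤ F r p) → ∀ r j, 0 ≤ ext F r j := by
    intro F hF r j
    by_cases hj : j ∈ Set.range e
    · obtain ⟨p, rfl⟩ := hj
      rw [hexte]; exact hF r p
    · rw [hext0 F r j hj]
  obtain ⟨M', hM', hle⟩ := exists_doublyStochastic_ge M (hext_nonneg _ fun r p => hW r p)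
    (fun r => by
      rw [← Fintype.sum_of_injective e e.injective (fun p => W r p) _
        (fun j hj => hM0 r j hj) (fun p => (hMe r p).symm)]
      exact (Finset.sum_coe_sort P' (fun p => W r p)).trans_le (hrow r r.2))
    (fun j => by
      by_cases hj : j ∈ Set.range e
      · obtain ⟨p, rfl⟩ := hj
        rw [Finset.sum_congr rfl fun r _ => hMe r p]
        exact (Finset.sum_coe_sort R' (fun r => W r p)).trans_le (hcol p p.2)
      · rw [Finset.sum_congr rfl fun r _ => hM0 r j hj]
        simp)
  obtain ⟨w, hw0, hw1, hwM⟩ := exists_eq_sum_perm_of_mem_doublyStochastic hM'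
  have hperm : ∀ σ : Equiv.Perm R', ∑ i, ∑ j, σ.permMatrix ℝ i j * S' i j ≤ maxSim S R' P' := by
    intro σ
    refine le_of_eq_of_le ?_ (sum_embedding_le_maxSim S (e.trans σ.symm.toEmbedding))
    have h1 : ∀ i, ∑ j, σ.permMatrix ℝ i j * S' i j = S' i (σ i) := by
      intro i
      simp [Equiv.Perm.permMatrix, PEquiv.toMatrix_apply]
    rw [Finset.sum_congr rfl fun i _ => h1 i]
    refine (Fintype.sum_of_injective (e.trans σ.symm.toEmbedding)
      (e.trans σ.symm.toEmbedding).injective _ _ ?_ ?_).symm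
    · intro i hi
      refine hS0 _ _ ?_
      rintro ⟨p, hp⟩
      exact hi ⟨p, by simp [hp]⟩
    · intro p
      simp only [Function.Embedding.trans_apply, Equiv.coe_toEmbedding, Equiv.apply_symm_apply]
      exact (hSe _ _).symm
  calc ∑ r ∈ R', ∑ p ∈ P', W r p * S r p = ∑ i, ∑ j, M i j * S' i j := by
        rw [← Finset.sum_coe_sort R']
        refine Finset.sum_congr rfl fun r _ => ?_
        rw [← Finset.sum_coe_sort P']
        refine Fintype.sum_of_injective e e.injective _ _ ?_ ?_
        · intro j hj
          simp [hS0 r j hj]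
        · intro p
          simp only [hMe, hSe]
    _ ≤ ∑ i, ∑ j, M' i j * S' i j :=
        Finset.sum_le_sum fun i _ => Finset.sum_le_sum fun j _ =>
          mul_le_mul_of_nonneg_right (hle i j) (hext_nonneg _ (fun r p => hS r p) i j)
    _ = ∑ σ, w σ * ∑ i, ∑ j, σ.permMatrix ℝ i j * S' i j := by
        simp only [← hwM, Matrix.sum_apply, Matrix.smul_apply, smul_eq_mul, Finset.sum_mul,
          Finset.mul_sum]
        rw [Finset.sum_congr rfl fun i _ => Finset.sum_comm, Finset.sum_comm]
        simp only [mul_assoc]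
    _ ≤ ∑ σ, w σ * maxSim S R' P' :=
        Finset.sum_le_sum fun σ _ => mul_le_mul_of_nonneg_left (hperm σ) (hw0 σ)
    _ = maxSim S R' P' := by rw [← Finset.sum_mul, hw1, one_mul]

/-! ### Weights for the two stages -/

section Weights
variable {nR n : ℕ}

/-- The papers of the reviewer `r`, when `V p` is the set of reviewers of the paper `p`. -/
def papersOf (V : Fin n → Finset (Fin nR)) (r : Fin nR) : Finset (Fin n) :=
  Finset.univ.filter fun p => r ∈ V p

theorem mem_papersOf {V : Fin n → Finset (Fin nR)} {r : Fin nR} {p : Fin n} :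
    p ∈ papersOf V r ↔ r ∈ V p := by simp [papersOf]

theorem sum_ite_mem_div_max {α : Type*} [DecidableEq α] (D T : Finset α) (c : ℝ) :
    ∑ e ∈ D, (if e ∈ T then 1 / max c ((D ∩ T).card : ℝ) else 0) ≤ 1 := by
  rw [← Finset.sum_filter, Finset.sum_const, Finset.filter_mem_eq_inter, nsmul_eq_mul,
    mul_one_div]
  rcases (D ∩ T).card.eq_zero_or_pos with h | h
  · simp [h]
  · have : (0 : ℝ) < (D ∩ T).card := by exact_mod_cast h
    exact div_le_one_of_le₀ (le_max_right _ _) (this.le.trans (le_max_right _ _))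

/-- The weights `1 / max μ X` form a fractional assignment: they give every paper load at most one,
and reviewers have at most `μ` papers. -/
theorem firstStage_le_maxSim {S : Matrix (Fin nR) (Fin n) ℝ} (hS : ∀ r p, 0 ≤ S r p)
    {V : Fin n → Finset (Fin nR)} {μ : ℕ} (hμ : 1 ≤ μ) (hV : ∀ r, (papersOf V r).card ≤ μ)
    {R₁ : Finset (Fin nR)} (hcard : n ≤ R₁.card) :
    ∑ p, ∑ r ∈ V p, (if r ∈ R₁ then 1 / max (μ : ℝ) ((R₁ ∩ V p).card : ℝ) else 0) * S r p
      ≤ maxSim S R₁ Finset.univ := by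
  have hμ' : (0 : ℝ) < μ := by exact_mod_cast hμ
  refine le_of_eq_of_le ?_ (sum_weight_le_maxSim hS (by simpa using hcard)
    (fun r p => if r ∈ V p then 1 / max (μ : ℝ) ((R₁ ∩ V p).card : ℝ) else 0) ?_ ?_ ?_)
  · rw [Finset.sum_comm (s := R₁)]
    refine Finset.sum_congr rfl fun p _ => ?_
    simp only [ite_mul, zero_mul]
    rw [← Finset.sum_filter, ← Finset.sum_filter, Finset.filter_mem_eq_inter,
      Finset.filter_mem_eq_inter, Finset.inter_comm]
  · intro r p
    split_ifs
    · exact one_div_nonneg.2 (hμ'.le.trans (le_max_left _ _))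
    · exact le_rfl
  · intro r _
    calc _ ≤ ∑ p : Fin n, (if r ∈ V p then 1 / (μ : ℝ) else 0) := by
          refine Finset.sum_le_sum fun p _ => ?_
          split_ifs
          · exact one_div_le_one_div_of_le hμ' (le_max_left _ _)
          · exact le_rfl
      _ = (papersOf V r).card / μ := by
          rw [← Finset.sum_filter, Finset.sum_const, nsmul_eq_mul, mul_one_div]; rfl
      _ ≤ 1 := by
          rw [div_le_one hμ']
          exact_mod_cast hV r
  · intro p _
    exact sum_ite_mem_div_max R₁ (V p) μ

/-- The edge weights `1 / max C Y Z` form a fractional assignment; they are at least `1 / max C Y +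
1 / max C Z - 1 / C`, which separates the two sources of loss. -/
theorem secondStage_le_maxSim {S : Matrix (Fin nR) (Fin n) ℝ} (hS : ∀ r p, 0 ≤ S r p)
    (V : Fin n → Finset (Fin nR)) {C : ℝ} (hC : 0 < C)
    {R₂ : Finset (Fin nR)} {P₂ : Finset (Fin n)} (hcard : P₂.card ≤ R₂.card) :
    ∑ p, ∑ r ∈ V p, (if r ∈ R₂ then if p ∈ P₂ then
        1 / max C ((R₂ ∩ V p).card : ℝ) + 1 / max C ((P₂ ∩ papersOf V r).card : ℝ) - 1 / C
        else 0 else 0) * S r p ≤ maxSim S R₂ P₂ := by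
  set Y : Fin n → ℝ := fun p => max C ((R₂ ∩ V p).card : ℝ) with hY
  set Z : Fin nR → ℝ := fun r => max C ((P₂ ∩ papersOf V r).card : ℝ) with hZ
  have hYC : ∀ p, C ≤ Y p := fun p => le_max_left _ _
  have hZC : ∀ r, C ≤ Z r := fun r => le_max_left _ _
  refine le_trans ?_ (sum_weight_le_maxSim hS hcard
    (fun r p => if r ∈ V p then 1 / max (Y p) (Z r) else 0) ?_ ?_ ?_)
  · calc _ ≤ ∑ p, ∑ r ∈ V p, (if r ∈ R₂ then if p ∈ P₂ then 1 / max (Y p) (Z r) * S r p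
            else 0 else 0) := by
          refine Finset.sum_le_sum fun p _ => Finset.sum_le_sum fun r _ => ?_
          split_ifs
          · refine mul_le_mul_of_nonneg_right ?_ (hS r p)
            have h1 : 1 / Y p ≤ 1 / C := one_div_le_one_div_of_le hC (hYC p)
            have h2 : 1 / Z r ≤ 1 / C := one_div_le_one_div_of_le hC (hZC r)
            rcases max_cases (Y p) (Z r) with ⟨h, -⟩ | ⟨h, -⟩ <;> rw [h] <;> linarith
          · simp
          · simp
      _ = _ := by
          rw [Finset.sum_comm (s := R₂), ← Finset.sum_subset (Finset.subset_univ P₂)]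
          · refine Finset.sum_congr rfl fun p hp => ?_
            simp only [ite_mul, zero_mul, hp, if_true]
            rw [← Finset.sum_filter, ← Finset.sum_filter, Finset.filter_mem_eq_inter,
              Finset.filter_mem_eq_inter, Finset.inter_comm]
          · intro p _ hp
            simp [hp]
  · intro r p
    split_ifs
    · exact one_div_nonneg.2 (hC.le.trans ((hYC p).trans (le_max_left _ _)))
    · exact le_rfl
  · intro r _
    refine le_trans (Finset.sum_le_sum fun p _ => ?_) (sum_ite_mem_div_max P₂ (papersOf V r) C)
    simp only [mem_papersOf]
    split_ifs
    · exact one_div_le_one_div_of_le (hC.trans_le (hZC r)) (le_max_right _ _)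
    · exact le_rfl
  · intro p _
    refine le_trans (Finset.sum_le_sum fun r _ => ?_) (sum_ite_mem_div_max R₂ (V p) C)
    split_ifs
    · exact one_div_le_one_div_of_le (hC.trans_le (hYC p)) (le_max_left _ _)
    · exact le_rfl
end Weights

/-! ### Expected weights -/

theorem mul_one_div_max {x c : ℝ} (hc : 0 < c) :
    x * (1 / max c x) = (x - max 0 (x - c)) / c := by
  rcases le_total x c with h | h
  · rw [max_eq_left h, max_eq_left (by linarith)]; ring
  · have : x ≠ 0 := (hc.trans_le h).ne'
    rw [max_eq_right h, max_eq_right (by linarith), mul_one_div_cancel this]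
    field_simp; ring

section Edge
variable {α : Type*} [Fintype α] [DecidableEq α]

theorem expect_one_div_max {T : Finset α} {e : α} (he : e ∈ T) {d : ℕ} (hd : d ≤ Fintype.card α)
    {c : ℝ} (hc : 0 < c) :
    𝔼 D ∈ Finset.powersetCard d (Finset.univ : Finset α),
        (if e ∈ D then 1 / max c ((D ∩ T).card : ℝ) else 0)
      = (T.card * ((d : ℝ) / Fintype.card α) -
          𝔼 D ∈ Finset.powersetCard d (Finset.univ : Finset α), max 0 (((D ∩ T).card : ℝ) - c)) /
        (T.card * c) := by
  rw [expect_mem_of_mem he d (fun x => 1 / max c (x : ℝ)),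
    Finset.expect_congr rfl fun D _ => mul_one_div_max hc, ← Finset.expect_div,
    Finset.expect_sub_distrib, expect_card_inter T hd, div_div, mul_comm c]

/-- Expected second-stage weight of an edge at a paper with `μ + F` reviewers. A deficit of
second-stage reviewers below `F` is an excess of first-stage reviewers over `μ`, so that the same
excess enters both stages. -/
theorem le_expect_one_div_max_of_compl {T : Finset α} {e : α} (he : e ∈ T) {d d' : ℕ}
    (hd : d + d' = Fintype.card α) {μ F C : ℕ} (hT : T.card = μ + F) (hFC : F ≤ C) (hC : 0 < C) :
    ((F : ℝ) - 𝔼 D ∈ Finset.powersetCard d' (Finset.univ : Finset α),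
        max 0 (((D ∩ T).card : ℝ) - μ)) / (T.card * C)
      ≤ 𝔼 D ∈ Finset.powersetCard d (Finset.univ : Finset α),
        (if e ∈ D then 1 / max (C : ℝ) ((D ∩ T).card : ℝ) else 0) := by
  have hC' : (0 : ℝ) < C := by exact_mod_cast hC
  rw [expect_mem_of_mem he d (fun x => 1 / max (C : ℝ) (x : ℝ)),
    Finset.expect_congr rfl fun D _ => mul_one_div_max hC', ← Finset.expect_div,
    div_div, mul_comm (C : ℝ)]
  refine div_le_div_of_nonneg_right ?_ (by positivity)
  rw [← expect_powersetCard_compl hd (fun D => max 0 (((D ∩ T).card : ℝ) - μ)), sub_le_iff_le_add,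
    ← Finset.expect_add_distrib,
    ← Finset.expect_const (powersetCard_univ_nonempty (α := α) (d := d) (by omega)) (F : ℝ)]
  refine Finset.expect_le_expect fun D _ => ?_
  have h : (D ∩ T).card + (Dᶜ ∩ T).card = T.card := by
    rw [← Finset.card_union_of_disjoint, ← Finset.union_inter_distrib_right, Finset.union_compl,
      Finset.univ_inter]
    exact Disjoint.mono Finset.inter_subset_left Finset.inter_subset_left disjoint_compl_right
  have h' : ((D ∩ T).card : ℝ) + ((Dᶜ ∩ T).card : ℝ) = μ + F := by exact_mod_cast h.trans hT
  have hF' : (F : ℝ) ≤ C := by exact_mod_cast hFC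
  have h1 := le_max_left 0 (((Dᶜ ∩ T).card : ℝ) - μ)
  have h2 := le_max_right 0 (((Dᶜ ∩ T).card : ℝ) - μ)
  rcases max_cases 0 (((D ∩ T).card : ℝ) - C) with ⟨h3, -⟩ | ⟨h3, -⟩ <;> rw [h3] <;> linarith

/-- Expected loss of an edge through an overloaded reviewer in the second stage. The loss grows with
the set of papers of the reviewer, so a set of exactly `μ` papers may be taken. -/
theorem expect_reviewer_loss_le {U : Finset α} {e : α} (he : e ∈ U) {d μ C : ℕ} (hU : U.card ≤ μ)
    (hd : d ≤ Fintype.card α) (hC : 0 < C) (hCμ : C ≤ μ) (hmean : μ * d ≤ Fintype.card α * C) :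
    𝔼 D ∈ Finset.powersetCard d (Finset.univ : Finset α),
        (if e ∈ D then 1 / (C : ℝ) - 1 / max (C : ℝ) ((D ∩ U).card : ℝ) else 0)
      ≤ √(C * ((μ : ℝ) - C) / (2 * Real.pi * μ)) / (μ * C) := by
  have hC' : (0 : ℝ) < C := by exact_mod_cast hC
  rcases le_or_gt μ (Fintype.card α) with h | h
  · obtain ⟨U', hUU', -, hU'⟩ := Finset.exists_subsuperset_card_eq (Finset.subset_univ U) hU
      (by simpa using h)
    calc _ ≤ 𝔼 D ∈ Finset.powersetCard d (Finset.univ : Finset α),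
          (if e ∈ D then 1 / (C : ℝ) - 1 / max (C : ℝ) ((D ∩ U').card : ℝ) else 0) := by
          refine Finset.expect_le_expect fun D _ => ?_
          split_ifs
          · have : ((D ∩ U).card : ℝ) ≤ (D ∩ U').card := by
              exact_mod_cast Finset.card_le_card (Finset.inter_subset_inter_left hUU')
            have := one_div_le_one_div_of_le (hC'.trans_le (le_max_left (C : ℝ) _))
              (max_le_max_left (C : ℝ) this)
            linarith
          · exact le_rfl
      _ = (𝔼 D ∈ Finset.powersetCard d (Finset.univ : Finset α),
            max 0 (((D ∩ U').card : ℝ) - C)) / (μ * C) := by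
          rw [expect_mem_of_mem (hUU' he) d (fun x => 1 / (C : ℝ) - 1 / max (C : ℝ) (x : ℝ)), hU',
            mul_comm (μ : ℝ), ← div_div, Finset.expect_div _ _ (C : ℝ)]
          congr 1
          refine Finset.expect_congr rfl fun D _ => ?_
          rw [mul_sub, mul_one_div_max hC']
          ring
      _ ≤ _ := by
          refine div_le_div_of_nonneg_right ?_ (by positivity)
          have := expect_posPart_le (T := U') (k := C) (by omega) hd (by rwa [hU'])
          rwa [hU'] at this
  -- There are fewer than `μ` papers in all, and `D` is too small to overload anyone.
  · have hdC : d ≤ C := by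
      have : μ * d ≤ μ * C := hmean.trans (Nat.mul_le_mul_right _ h.le)
      exact Nat.le_of_mul_le_mul_left this (by omega)
    rw [Finset.expect_eq_zero]
    · positivity
    · intro D hD
      have : ((D ∩ U).card : ℝ) ≤ C := by
        have h1 := Finset.card_le_card (Finset.inter_subset_left (s₁ := D) (s₂ := U))
        rw [Finset.mem_powersetCard_univ.1 hD] at h1
        exact_mod_cast h1.trans hdC
      rw [max_eq_left this]; simp
end Edge

theorem randomSplitValue_nonneg {nR n : ℕ} {S : Matrix (Fin nR) (Fin n) ℝ}
    (hS : ∀ r p, 0 ≤ S r p) (k m : ℕ) : 0 ≤ randomSplitValue S k m :=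
  Finset.expect_nonneg fun _ _ => Finset.expect_nonneg fun _ _ =>
    div_nonneg (add_nonneg (maxSim_nonneg hS _ _) (maxSim_nonneg hS _ _)) (by positivity)

/-- Lower bound for random split from an assignment with exactly `t` reviewers per paper, in terms
of the expected weight of an edge. -/
theorem randomSplitValue_ge {nR n n₂ m μ F C t : ℕ} {S : Matrix (Fin nR) (Fin n) ℝ}
    (hS : ∀ r p, 0 ≤ S r p) {V : Fin n → Finset (Fin nR)} (hVt : ∀ p, (V p).card = t)
    (hV : ∀ r, (papersOf V r).card ≤ μ) (ht : t = μ + F) (hFC : F ≤ C) (hC : 0 < C) (hCμ : C ≤ μ)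
    (hn₂ : n₂ ≤ n) (hm : m ≤ nR) (hfirst : n ≤ nR - m) (hsecond : n₂ ≤ m)
    (hmean₁ : t * (nR - m) ≤ nR * μ) (hmean₂ : μ * n₂ ≤ n * C) :
    (((t : ℝ) * ((nR - m : ℕ) / nR) - √(μ * ((t : ℝ) - μ) / (2 * Real.pi * t))) / (t * μ) +
      ((n₂ : ℝ) / n * ((F - √(μ * ((t : ℝ) - μ) / (2 * Real.pi * t))) / (t * C)) -
      (m : ℝ) / nR * (√(C * ((μ : ℝ) - C) / (2 * Real.pi * μ)) / (μ * C)))) *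
      (∑ p, ∑ r ∈ V p, S r p) / ((n : ℝ) + n₂)
      ≤ randomSplitValue S n₂ m := by
  set l := √(μ * ((t : ℝ) - μ) / (2 * Real.pi * t)) with hl
  set h := √(C * ((μ : ℝ) - C) / (2 * Real.pi * μ)) with hh
  have hμ0 : 0 < μ := by omega
  have hμ' : (0 : ℝ) < μ := by exact_mod_cast hμ0
  have hC' : (0 : ℝ) < C := by exact_mod_cast hC
  set Ω₁ := Finset.powersetCard m (Finset.univ : Finset (Fin nR)) with hΩ₁
  set Ω₂ := Finset.powersetCard n₂ (Finset.univ : Finset (Fin n)) with hΩ₂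
  have hne₂ : Ω₂.Nonempty := powersetCard_univ_nonempty (by simpa using hn₂)
  have hne₁ : Ω₁.Nonempty := powersetCard_univ_nonempty (by simpa using hm)
  set w₁ : Finset (Fin nR) → Fin n → Fin nR → ℝ := fun R₂ p r =>
    if r ∈ R₂ᶜ then 1 / max (μ : ℝ) ((R₂ᶜ ∩ V p).card : ℝ) else 0 with hw₁
  set a : Finset (Fin nR) → Fin n → ℝ := fun R₂ p => 1 / max (C : ℝ) ((R₂ ∩ V p).card : ℝ) with ha
  set b : Finset (Fin n) → Fin nR → ℝ := fun P₂ r =>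
    1 / max (C : ℝ) ((P₂ ∩ papersOf V r).card : ℝ) with hb
  set w₂ : Finset (Fin nR) → Finset (Fin n) → Fin n → Fin nR → ℝ := fun R₂ P₂ p r =>
    if r ∈ R₂ then if p ∈ P₂ then a R₂ p + b P₂ r - 1 / C else 0 else 0 with hw₂
  have hc0 : (0 : ℝ) ≤ (n : ℝ) + n₂ := by positivity
  have hQ : ∀ R₂ ∈ Ω₁, ∀ P₂ ∈ Ω₂,
      (∑ p, ∑ r ∈ V p, (w₁ R₂ p r + w₂ R₂ P₂ p r) * S r p) / ((n : ℝ) + n₂) ≤ Q S R₂ P₂ := by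
    intro R₂ hR₂ P₂ hP₂
    have hR := Finset.mem_powersetCard_univ.1 hR₂
    have hP := Finset.mem_powersetCard_univ.1 hP₂
    rw [Q, hP]
    refine div_le_div_of_nonneg_right ?_ hc0
    simp only [add_mul, Finset.sum_add_distrib]
    refine add_le_add (firstStage_le_maxSim hS hμ0 hV ?_) (secondStage_le_maxSim hS V hC' ?_)
    · rw [Finset.card_compl, hR, Fintype.card_fin]; exact hfirst
    · rw [hR, hP]; exact hsecond
  -- Lower bound for the expected weight of a single edge.
  have hedge : ∀ p, ∀ r ∈ V p,
      ((t : ℝ) * ((nR - m : ℕ) / nR) - l) / (t * μ) +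
        ((n₂ : ℝ) / n * ((F - l) / (t * C)) - (m : ℝ) / nR * (h / (μ * C)))
      ≤ 𝔼 R₂ ∈ Ω₁, 𝔼 P₂ ∈ Ω₂, (w₁ R₂ p r + w₂ R₂ P₂ p r) := by
    intro p r hr
    have hcard : m + (nR - m) = Fintype.card (Fin nR) := by rw [Fintype.card_fin]; omega
    have hL := expect_posPart_le (T := V p) (k := μ) (d := nR - m) (by rw [hVt]; omega)
      (by omega) (by rw [hVt, Fintype.card_fin]; exact hmean₁)
    rw [hVt, ← hl] at hL
    have e1 : ((t : ℝ) * ((nR - m : ℕ) / nR) - l) / (t * μ) ≤ 𝔼 R₂ ∈ Ω₁, w₁ R₂ p r := by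
      rw [hΩ₁, hw₁, expect_powersetCard_compl hcard
        (fun D => if r ∈ D then 1 / max (μ : ℝ) ((D ∩ V p).card : ℝ) else 0),
        expect_one_div_max hr (by omega) hμ', hVt, Fintype.card_fin]
      refine div_le_div_of_nonneg_right (by linarith) (by positivity)
    have e2 : (F - l) / (t * C) ≤ 𝔼 R₂ ∈ Ω₁, (if r ∈ R₂ then a R₂ p else 0) := by
      refine le_trans ?_ (le_expect_one_div_max_of_compl hr hcard ((hVt p).trans ht) hFC hC)
      rw [hVt]
      exact div_le_div_of_nonneg_right (by linarith) (by positivity)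
    have e3 : 𝔼 P₂ ∈ Ω₂, (if p ∈ P₂ then 1 / (C : ℝ) - b P₂ r else 0) ≤ h / (μ * C) :=
      expect_reviewer_loss_le (mem_papersOf.2 hr) (hV r) (by simpa using hn₂) hC hCμ
        (by simpa using hmean₂)
    have e4 : ∀ R₂, (if r ∈ R₂ then a R₂ p else 0) * ((n₂ : ℝ) / n) -
        (if r ∈ R₂ then h / (μ * C) else 0) ≤ 𝔼 P₂ ∈ Ω₂, w₂ R₂ P₂ p r := by
      intro R₂
      simp only [hw₂]
      split_ifs with hrR
      · have h1 := expect_mem p (d := n₂) (by simpa using hn₂) (a R₂ p)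
        rw [Fintype.card_fin] at h1
        have h2 : ∀ P₂, (if p ∈ P₂ then a R₂ p + b P₂ r - 1 / C else 0)
            = (if p ∈ P₂ then a R₂ p else 0) - (if p ∈ P₂ then 1 / (C : ℝ) - b P₂ r else 0) := by
          intro P₂
          split_ifs <;> ring
        rw [Finset.expect_congr rfl fun P₂ _ => h2 P₂, Finset.expect_sub_distrib, h1]
        linarith
      · simp
    have e5 : (n₂ : ℝ) / n * ((F - l) / (t * C)) - (m : ℝ) / nR * (h / (μ * C))
        ≤ 𝔼 R₂ ∈ Ω₁, 𝔼 P₂ ∈ Ω₂, w₂ R₂ P₂ p r := by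
      refine le_trans ?_ (Finset.expect_le_expect fun R₂ _ => e4 R₂)
      rw [Finset.expect_sub_distrib, ← Finset.expect_mul, expect_mem r (by simpa using hm),
        Fintype.card_fin, mul_comm]
      have : (0 : ℝ) ≤ (n₂ : ℝ) / n := by positivity
      have := mul_le_mul_of_nonneg_right e2 this
      linarith
    simp only [Finset.expect_add_distrib, Finset.expect_const hne₂]
    exact add_le_add e1 e5
  calc _ ≤ (∑ p, ∑ r ∈ V p, (𝔼 R₂ ∈ Ω₁, 𝔼 P₂ ∈ Ω₂, (w₁ R₂ p r + w₂ R₂ P₂ p r)) * S r p) /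
        ((n : ℝ) + n₂) := by
        refine div_le_div_of_nonneg_right ?_ hc0
        rw [Finset.mul_sum]
        refine Finset.sum_le_sum fun p _ => ?_
        rw [Finset.mul_sum]
        exact Finset.sum_le_sum fun r hr => mul_le_mul_of_nonneg_right (hedge p r hr) (hS r p)
    _ = 𝔼 R₂ ∈ Ω₁, 𝔼 P₂ ∈ Ω₂,
        (∑ p, ∑ r ∈ V p, (w₁ R₂ p r + w₂ R₂ P₂ p r) * S r p) / ((n : ℝ) + n₂) := by
        simp only [← Finset.expect_div, Finset.expect_sum_comm, ← Finset.expect_mul]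
    _ ≤ randomSplitValue S n₂ m :=
        Finset.expect_le_expect fun R₂ hR₂ => Finset.expect_le_expect fun P₂ hP₂ =>
          hQ R₂ hR₂ P₂ hP₂

/-! ### The loss in closed form -/

/-- Moving the success probability from `μ / t` to `1 / (1 + β) ≥ 1 / 2`, thus closer to `1 / 2`,
increases the variance. -/
theorem paper_loss_bound {β μ t : ℝ} (hβ0 : 0 < β) (hβ1 : β ≤ 1) (ht0 : 0 < t)
    (htT : t ≤ (1 + β) * μ) :
    √(μ * (t - μ) / (2 * Real.pi * t)) / t
      ≤ √(β / (2 * Real.pi * (1 + β) * t)) * √(1 / (1 + β)) := by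
  have hπ := Real.pi_pos
  rw [div_le_iff₀ ht0, ← Real.sqrt_mul (by positivity)]
  refine Real.sqrt_le_iff.2 ⟨by positivity, ?_⟩
  rw [mul_pow, Real.sq_sqrt (by positivity), div_le_iff₀ (by positivity)]
  have key : μ * (t - μ) * (1 + β) ^ 2 ≤ β * t ^ 2 := by
    have hδ : 0 ≤ (1 + β) * μ - t := by linarith
    nlinarith [mul_nonneg hδ ht0.le, mul_nonneg (mul_nonneg hδ ht0.le) (sub_nonneg.2 hβ1),
      sq_nonneg ((1 + β) * μ - t)]
  have e : β / (2 * Real.pi * (1 + β) * t) * (1 / (1 + β)) * t ^ 2 * (2 * Real.pi * t)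
      = β * t ^ 2 / (1 + β) ^ 2 := by field_simp
  rw [e, le_div_iff₀ (by positivity)]
  exact key

/-- Rounding `β μ` up to `C` increases the standard deviation by at most `ε`. -/
theorem reviewer_loss_bound {β μ C ε : ℝ} (hβ0 : 0 < β) (hβ1 : β ≤ 1) (hμ : 0 < μ) (hC : 0 < C)
    (hCβ : β * μ ≤ C) (hCε : C - β * μ ≤ ε) (hε : ε = 0 ∨ ε = 1) :
    √(C * (μ - C) / (2 * Real.pi * μ)) ≤ √(μ * β * (1 - β) / (2 * Real.pi)) + ε := by
  have hπ := Real.pi_pos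
  have hε0 : 0 ≤ ε := by rcases hε with h | h <;> norm_num [h]
  have hβ1' : 0 ≤ 1 - β := by linarith
  set g := √(μ * β * (1 - β) / (2 * Real.pi)) with hg
  have hg0 : 0 ≤ g := Real.sqrt_nonneg _
  refine Real.sqrt_le_iff.2 ⟨by positivity, ?_⟩
  have hg2 : g ^ 2 = μ * β * (1 - β) / (2 * Real.pi) := Real.sq_sqrt (by positivity)
  have e1 : C * (μ - C) ≤ β * μ * (μ - β * μ) + ε * μ := by
    have hη : 0 ≤ C - β * μ := by linarith
    nlinarith [mul_nonneg hη (mul_pos hβ0 hμ).le, mul_nonneg hη hC.le,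
      mul_le_mul_of_nonneg_right hCε hμ.le]
  have e2 : C * (μ - C) / (2 * Real.pi * μ)
      ≤ (β * μ * (μ - β * μ) + ε * μ) / (2 * Real.pi * μ) :=
    div_le_div_of_nonneg_right e1 (by positivity)
  have e3 : (β * μ * (μ - β * μ) + ε * μ) / (2 * Real.pi * μ) = g ^ 2 + ε / (2 * Real.pi) := by
    rw [hg2]; field_simp
  have e4 : ε / (2 * Real.pi) ≤ ε ^ 2 := by
    have hε2 : ε ^ 2 = ε := by rcases hε with h | h <;> norm_num [h]
    rw [hε2]
    exact div_le_self hε0 (by linarith [Real.pi_gt_three])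
  nlinarith [mul_nonneg hg0 hε0]

theorem reviewer_loss_rescale {β μ C t : ℝ} (hβ0 : 0 < β) (hβ1 : β ≤ 1) (hμ : 0 < μ)
    (ht0 : 0 < t) (htT : t ≤ (1 + β) * μ) (hCβ : β * μ ≤ C) :
    β / (1 + β) * √(μ * β * (1 - β) / (2 * Real.pi))
      ≤ C * (√(β / (2 * Real.pi * (1 + β) * t)) * √(1 - β)) := by
  have hπ := Real.pi_pos
  have hβ1' : 0 ≤ 1 - β := by linarith
  have e1 : β / (1 + β) * √(μ * β * (1 - β) / (2 * Real.pi))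
      ≤ β * μ * (√(β / (2 * Real.pi * (1 + β) * t)) * √(1 - β)) := by
    rw [← Real.sqrt_mul (by positivity)]
    refine abs_le_of_sq_le_sq' ?_ (by positivity) |>.2
    rw [mul_pow, mul_pow, Real.sq_sqrt (by positivity), Real.sq_sqrt (by positivity)]
    have e : (β / (1 + β)) ^ 2 * (μ * β * (1 - β) / (2 * Real.pi))
        = β ^ 2 * μ ^ 2 * (β * (1 - β) / (2 * Real.pi * (1 + β) * ((1 + β) * μ))) := by
      field_simp
    rw [e, mul_pow, div_mul_eq_mul_div]
    refine mul_le_mul_of_nonneg_left ?_ (by positivity)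
    exact div_le_div_of_nonneg_left (by positivity) (by positivity)
      (mul_le_mul_of_nonneg_left htT (by positivity))
  exact e1.trans (mul_le_mul_of_nonneg_right hCβ (by positivity))

/-- The expected weight of an edge, with its losses in closed form; `ε` is the rounding error of
`β μ`. -/
theorem edge_weight_ge {β μ F C t ε : ℝ} (hβ0 : 0 < β) (hβ1 : β ≤ 1) (hμ : 0 < μ)
    (hF0 : 0 ≤ F) (hC : 0 < C) (hFC : F = C - ε) (ht : t = μ + F) (hF : F ≤ β * μ)
    (hCβ : β * μ ≤ C) (hε : ε = 0 ∨ ε = 1) :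
    (1 - √(β / (2 * Real.pi * (1 + β) * t)) * (2 * √(1 / (1 + β)) + √(1 - β))
        - (1 + 2 * β) / ((1 + β) * C) * ε) / μ
      ≤ (t * (1 / (1 + β)) - √(μ * (t - μ) / (2 * Real.pi * t))) / (t * μ) +
        (β * ((F - √(μ * (t - μ) / (2 * Real.pi * t))) / (t * C)) -
        β / (1 + β) * (√(C * (μ - C) / (2 * Real.pi * μ)) / (μ * C))) := by
  have hπ := Real.pi_pos
  have ht0 : 0 < t := by linarith
  have hε0 : 0 ≤ ε := by rcases hε with h | h <;> norm_num [h]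
  set l := √(μ * (t - μ) / (2 * Real.pi * t)) with hl
  set h := √(C * (μ - C) / (2 * Real.pi * μ)) with hh
  set a := √(β / (2 * Real.pi * (1 + β) * t)) * √(1 / (1 + β)) with ha
  set b := √(β / (2 * Real.pi * (1 + β) * t)) * √(1 - β) with hb
  set q := β / (1 + β) with hq
  have hq0 : 0 ≤ q := by positivity
  have hq1 : q ≤ 1 := by rw [hq, div_le_one (by positivity)]; linarith
  have hpq : 1 / (1 + β) = 1 - q := by rw [hq]; field_simp; ring
  have htT : t ≤ (1 + β) * μ := by linarith
  have hl0 : 0 ≤ l := Real.sqrt_nonneg _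
  have h1 : l / t ≤ a := paper_loss_bound hβ0 hβ1 ht0 htT
  have h2 : β * μ * l / (t * C) ≤ a := by
    refine le_trans ?_ h1
    rw [div_le_div_iff₀ (by positivity) ht0]
    have := mul_le_mul_of_nonneg_right hCβ (mul_nonneg hl0 ht0.le)
    nlinarith
  have h3 : q * (1 - ε / C) ≤ β * μ * F / (t * C) := by
    have e : β * μ * F / (t * C) = β * μ / t * (1 - ε / C) := by rw [hFC]; field_simp
    rw [e]
    refine mul_le_mul_of_nonneg_right ?_ ?_
    · rw [hq, div_le_div_iff₀ (by positivity) ht0]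
      nlinarith
    · rw [sub_nonneg, div_le_one hC]; linarith
  set g := √(μ * β * (1 - β) / (2 * Real.pi)) with hg
  have hβ1' : 0 ≤ 1 - β := by linarith
  have hg0 : 0 ≤ g := Real.sqrt_nonneg _
  have h4 : h ≤ g + ε := reviewer_loss_bound hβ0 hβ1 hμ hC hCβ (by linarith) hε
  have h5 : q * g ≤ C * b := reviewer_loss_rescale hβ0 hβ1 hμ ht0 htT hCβ
  have h6 : q * h / C ≤ b + ε / C := by
    rw [div_le_iff₀ hC, add_mul, div_mul_cancel₀ _ hC.ne']
    nlinarith [mul_le_mul_of_nonneg_left h4 hq0, mul_le_mul_of_nonneg_right hq1 hε0]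
  have hR : (t * (1 / (1 + β)) - l) / (t * μ) + (β * ((F - l) / (t * C)) - q * (h / (μ * C)))
      = (1 / (1 + β) - l / t + (β * μ * F / (t * C) - β * μ * l / (t * C)) - q * h / C) / μ := by
    field_simp
    ring
  have hε' : (1 + 2 * β) / ((1 + β) * C) * ε = (1 + q) * (ε / C) := by
    rw [hq]; field_simp; ring
  rw [hR, hε', hpq]
  refine div_le_div_of_nonneg_right ?_ hμ.le
  have : √(β / (2 * Real.pi * (1 + β) * t)) * (2 * √(1 - q) + √(1 - β)) = 2 * a + b := by
    rw [ha, hb, hpq]; ring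
  rw [this]
  nlinarith

/-! ### Equalizing the paper loads -/

/-- The `t` largest weights have at least their share of the total. -/
theorem exists_subset_card_eq_sum_ge {α : Type*} [DecidableEq α] (U : Finset α) (w : α → ℝ)
    (hw : ∀ a, 0 ≤ w a) {t : ℕ} (ht : t ≤ U.card) :
    ∃ V ⊆ U, V.card = t ∧ t * ∑ a ∈ U, w a ≤ U.card * ∑ a ∈ V, w a := by
  induction hU : U.card - t generalizing U with
  | zero => exact ⟨U, Finset.Subset.rfl, by omega, by rw [show t = U.card by omega]⟩
  | succ j ih =>
    obtain ⟨a, ha, hmin⟩ := U.exists_min_image w (Finset.card_pos.1 (by omega))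
    have hc := Finset.card_erase_of_mem ha
    obtain ⟨V, hV, hVt, hle⟩ := ih (U.erase a) (by omega) (by omega)
    refine ⟨V, hV.trans (Finset.erase_subset a U), hVt, ?_⟩
    have h1 : (U.card : ℝ) * w a ≤ ∑ b ∈ U, w b := by
      rw [← nsmul_eq_mul]
      exact Finset.card_nsmul_le_sum _ _ _ hmin
    have h2 := Finset.add_sum_erase U w ha
    have hpos : 1 ≤ U.card := by omega
    have h3 : ((U.erase a).card : ℝ) = U.card - 1 := by
      rw [hc, Nat.cast_sub hpos, Nat.cast_one]
    rw [h3] at hle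
    rcases hpos.eq_or_lt with h4 | h4
    · -- then `t = 0`
      have : t = 0 := by omega
      subst this
      have := Finset.sum_nonneg fun b (_ : b ∈ V) => hw b
      simp only [Nat.cast_zero, zero_mul]
      positivity
    · have h5 : (2 : ℝ) ≤ U.card := by exact_mod_cast h4
      set s := ∑ b ∈ U, w b
      set v := ∑ b ∈ V, w b
      have ht0 : (0 : ℝ) ≤ t := Nat.cast_nonneg t
      have h6 : ((U.card : ℝ) - 1) * s ≤ U.card * ∑ b ∈ U.erase a, w b := by
        rw [← h2] at h1 ⊢; nlinarith
      have h7 : ((U.card : ℝ) - 1) * (t * s) ≤ ((U.card : ℝ) - 1) * (U.card * v) := by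
        calc ((U.card : ℝ) - 1) * (t * s) = t * (((U.card : ℝ) - 1) * s) := by ring
          _ ≤ t * (U.card * ∑ b ∈ U.erase a, w b) := mul_le_mul_of_nonneg_left h6 ht0
          _ = U.card * (t * ∑ b ∈ U.erase a, w b) := by ring
          _ ≤ U.card * (((U.card : ℝ) - 1) * v) :=
            mul_le_mul_of_nonneg_left hle (by linarith)
          _ = _ := by ring
      exact le_of_mul_le_mul_left h7 (by linarith)

/-- The most similar `⌊ℓpap⌋` reviewers of each paper retain a fraction `⌊ℓpap⌋ / ⌈ℓpap⌉` of the
total similarity. -/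
theorem exists_trim {nR n ℓrev t T : ℕ} {ℓpap : ℝ} {S : Matrix (Fin nR) (Fin n) ℝ}
    (hS : ∀ r p, 0 ≤ S r p) {A : Matrix (Fin nR) (Fin n) ℕ}
    (hA : A ∈ validAssignments Finset.univ Finset.univ ℓrev ℓpap) (ht : ⌊ℓpap⌋₊ = t)
    (hT : ⌈ℓpap⌉₊ = T) :
    ∃ V : Fin n → Finset (Fin nR), (∀ p, (V p).card = t) ∧
      (∀ r, (papersOf V r).card ≤ ℓrev) ∧
      t * totalSim S A ≤ T * ∑ p, ∑ r ∈ V p, S r p := by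
  obtain ⟨h01, hpap, hrev, -⟩ := hA
  have hite : ∀ r p, A r p = if A r p = 1 then 1 else 0 := by
    intro r p
    rcases h01 r p with h | h <;> simp [h]
  set U : Fin n → Finset (Fin nR) := fun p => Finset.univ.filter fun r => A r p = 1 with hU
  have hUcard : ∀ p, (U p).card = ∑ r, A r p := by
    intro p
    rw [Finset.card_filter]
    exact Finset.sum_congr rfl fun r _ => (hite r p).symm
  have hchoose : ∀ p, ∃ V ⊆ U p, V.card = t ∧
      t * ∑ r ∈ U p, S r p ≤ (U p).card * ∑ r ∈ V, S r p := fun p =>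
    exists_subset_card_eq_sum_ge (U p) (fun r => S r p) (fun r => hS r p)
      (by rw [hUcard, ← ht]; exact (hpap p (Finset.mem_univ p)).1)
  choose V hVU hVt hVS using hchoose
  refine ⟨V, hVt, fun r => ?_, ?_⟩
  · refine le_trans ?_ (hrev r (Finset.mem_univ r))
    rw [papersOf, Finset.card_filter]
    refine Finset.sum_le_sum fun p _ => ?_
    split_ifs with h
    · exact ((Finset.mem_filter.1 (hVU p h)).2).ge
    · exact Nat.zero_le _
  · have htot : totalSim S A = ∑ p, ∑ r ∈ U p, S r p := by
      rw [totalSim, Finset.sum_comm]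
      refine Finset.sum_congr rfl fun p _ => ?_
      rw [Finset.sum_filter]
      refine Finset.sum_congr rfl fun r _ => ?_
      rcases h01 r p with h | h <;> simp [h]
    rw [htot, Finset.mul_sum, Finset.mul_sum]
    refine Finset.sum_le_sum fun p _ => (hVS p).trans ?_
    refine mul_le_mul_of_nonneg_right ?_ (Finset.sum_nonneg fun r _ => hS r p)
    rw [hUcard, ← hT]
    exact_mod_cast (hpap p (Finset.mem_univ p)).2

/-! ### The lower bound for random split -/

/-- The general bound, for any real `β ∈ (0, 1]` and any positive `μ`. -/
theorem randomSplitValue_ge_of_validAssignment {n nR n₂ m μ : ℕ} {β : ℝ}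
    (hn : 1 ≤ n) (hμ : 1 ≤ μ) (hβ0 : 0 < β) (hβ1 : β ≤ 1)
    (hn₂ : (n₂ : ℝ) = β * (n : ℝ))
    (hnR : (1 + β) * (n : ℝ) ≤ (nR : ℝ))
    (hm : (m : ℝ) = β / (1 + β) * (nR : ℝ))
    {S : Matrix (Fin nR) (Fin n) ℝ} (hS : ∀ r p, 0 ≤ S r p)
    {A : Matrix (Fin nR) (Fin n) ℕ}
    (hA : A ∈ validAssignments Finset.univ Finset.univ μ ((1 + β) * (μ : ℝ)))
    {s : ℝ} (hs : s = meanSim S ((1 + β) * (μ : ℝ)) A)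
    {ε : ℝ} (hε : ε = (⌈β * (μ : ℝ)⌉₊ : ℝ) - (⌊β * (μ : ℝ)⌋₊ : ℝ)) :
    s * (1 - √(β / (2 * Real.pi * (1 + β) * (⌊(1 + β) * (μ : ℝ)⌋₊ : ℝ))) *
            (2 * √(1 / (1 + β)) + √(1 - β))
          - (1 + 2 * β) / ((1 + β) * (⌈β * (μ : ℝ)⌉₊ : ℝ)) * ε) *
        (1 - ε / (⌈(1 + β) * (μ : ℝ)⌉₊ : ℝ)) ≤ randomSplitValue S n₂ m := by
  have hn' : (0 : ℝ) < n := by exact_mod_cast hn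
  have hμ' : (0 : ℝ) < μ := by exact_mod_cast hμ
  have hc0 : 0 < β * (μ : ℝ) := by positivity
  have hTeq : (1 + β) * (μ : ℝ) = β * μ + (μ : ℕ) := by ring
  have ht : ⌊(1 + β) * (μ : ℝ)⌋₊ = μ + ⌊β * (μ : ℝ)⌋₊ := by
    rw [hTeq, Nat.floor_add_natCast hc0.le, add_comm]
  have hT : ⌈(1 + β) * (μ : ℝ)⌉₊ = μ + ⌈β * (μ : ℝ)⌉₊ := by
    rw [hTeq, Nat.ceil_add_natCast hc0.le, add_comm]
  obtain ⟨V, hVt, hV, hVS⟩ := exists_trim hS hA ht hT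
  rw [ht, hT]
  have hFle : (⌊β * (μ : ℝ)⌋₊ : ℝ) ≤ β * μ := Nat.floor_le hc0.le
  have hCge : β * (μ : ℝ) ≤ ⌈β * (μ : ℝ)⌉₊ := Nat.le_ceil _
  have hC : 0 < ⌈β * (μ : ℝ)⌉₊ := Nat.ceil_pos.2 hc0
  have hCμ : ⌈β * (μ : ℝ)⌉₊ ≤ μ := Nat.ceil_le.2 (by nlinarith)
  have hFC : ⌊β * (μ : ℝ)⌋₊ ≤ ⌈β * (μ : ℝ)⌉₊ := Nat.floor_le_ceil _
  have hCF : ⌈β * (μ : ℝ)⌉₊ ≤ ⌊β * (μ : ℝ)⌋₊ + 1 := Nat.ceil_le_floor_add_one _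
  set F := ⌊β * (μ : ℝ)⌋₊
  set C := ⌈β * (μ : ℝ)⌉₊
  have hC' : (0 : ℝ) < C := by exact_mod_cast hC
  have hε01 : ε = 0 ∨ ε = 1 := by
    rcases (show C = F ∨ C = F + 1 by omega) with h | h
    · left; rw [hε, h, sub_self]
    · right; rw [hε, h]; push_cast; ring
  have hnR0 : (0 : ℝ) < nR := lt_of_lt_of_le (by positivity) hnR
  have hn₂n : n₂ ≤ n := by
    have : (n₂ : ℝ) ≤ n := by rw [hn₂]; nlinarith
    exact_mod_cast this
  have hmR : m ≤ nR := by
    have : (m : ℝ) ≤ nR := by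
      rw [hm]
      exact mul_le_of_le_one_left hnR0.le ((div_le_one (by positivity)).2 (by linarith))
    exact_mod_cast this
  have hd : ((nR - m : ℕ) : ℝ) = 1 / (1 + β) * nR := by
    rw [Nat.cast_sub hmR, hm]; field_simp; ring
  have hfirst : n ≤ nR - m := by
    have : (n : ℝ) ≤ (nR - m : ℕ) := by
      rw [hd, one_div_mul_eq_div, le_div_iff₀ (by positivity)]; linarith
    exact_mod_cast this
  have hsecond : n₂ ≤ m := by
    have : (n₂ : ℝ) ≤ m := by
      rw [hn₂, hm, div_mul_eq_mul_div, le_div_iff₀ (by positivity)]; nlinarith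
    exact_mod_cast this
  have hmean₁ : (μ + F) * (nR - m) ≤ nR * μ := by
    have : ((μ + F : ℕ) : ℝ) * (nR - m : ℕ) ≤ nR * μ := by
      rw [hd, one_div_mul_eq_div, mul_div_assoc', div_le_iff₀ (by positivity)]
      push_cast
      nlinarith
    exact_mod_cast this
  have hmean₂ : μ * n₂ ≤ n * C := by
    have : (μ : ℝ) * n₂ ≤ n * C := by
      rw [hn₂]; nlinarith
    exact_mod_cast this
  have hmain := randomSplitValue_ge hS hVt hV rfl hFC hC hCμ hn₂n hmR hfirst hsecond hmean₁ hmean₂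
  have hκ := edge_weight_ge (β := β) (μ := μ) (F := F) (C := C) (t := (μ + F : ℕ)) (ε := ε)
    hβ0 hβ1 hμ' (Nat.cast_nonneg _) hC' (by rw [hε]; ring) (by push_cast; ring) hFle hCge hε01
  rw [hd, hn₂, hm, mul_div_cancel_right₀ _ hnR0.ne', mul_div_cancel_right₀ _ hnR0.ne',
    mul_div_cancel_right₀ _ hn'.ne'] at hmain
  set B := 1 - √(β / (2 * Real.pi * (1 + β) * ((μ + F : ℕ) : ℝ))) *
            (2 * √(1 / (1 + β)) + √(1 - β)) - (1 + 2 * β) / ((1 + β) * (C : ℝ)) * ε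
  have htot0 : 0 ≤ totalSim S A := Finset.sum_nonneg fun r _ => Finset.sum_nonneg fun p _ =>
    mul_nonneg (Nat.cast_nonneg _) (hS r p)
  have hs0 : 0 ≤ s := by rw [hs, meanSim]; positivity
  have hρ : 1 - ε / ((μ + C : ℕ) : ℝ) = ((μ + F : ℕ) : ℝ) / ((μ + C : ℕ) : ℝ) := by
    have : ((μ + C : ℕ) : ℝ) ≠ 0 := by positivity
    rw [eq_div_iff this, sub_mul, div_mul_cancel₀ _ this, hε]
    push_cast; ring
  rw [hρ]
  -- A negative bracket makes the bound trivial, as no similarity is negative.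
  rcases le_total B 0 with hB | hB
  · exact (mul_nonpos_of_nonpos_of_nonneg (mul_nonpos_of_nonneg_of_nonpos hs0 hB)
      (by positivity)).trans (randomSplitValue_nonneg hS _ _)
  · refine le_trans ?_ hmain
    have hVs : ((μ + F : ℕ) : ℝ) / ((μ + C : ℕ) : ℝ) * totalSim S A
        ≤ ∑ p, ∑ r ∈ V p, S r p := by
      rw [div_mul_eq_mul_div, div_le_iff₀ (by positivity), mul_comm _ ((μ + C : ℕ) : ℝ)]
      exact hVS
    have e : s * B * (((μ + F : ℕ) : ℝ) / ((μ + C : ℕ) : ℝ))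
        = B / μ * (((μ + F : ℕ) : ℝ) / ((μ + C : ℕ) : ℝ) * totalSim S A) / (n + β * n) := by
      rw [hs, meanSim]; field_simp
    rw [e]
    refine div_le_div_of_nonneg_right ?_ (by positivity)
    exact mul_le_mul hκ hVs (by positivity) ((by positivity : 0 ≤ B / μ).trans hκ)

end TwoStage

theorem theorem5 (n nR n₂ m μ : ℕ) (β : ℝ)
    (hn : 1 ≤ n) (hμ : 1 ≤ μ) (hμ' : μ ≤ 10000)
    (hβ : ∃ b : ℕ, 1 ≤ b ∧ b ≤ 100 ∧ β = (b : ℝ) / 100)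
    (hn₂ : (n₂ : ℝ) = β * (n : ℝ))
    (hnR : (1 + β) * (n : ℝ) ≤ (nR : ℝ))
    (hm : (m : ℝ) = β / (1 + β) * (nR : ℝ))
    (S : Matrix (Fin nR) (Fin n) ℝ) (hS : ∀ r p, S r p ∈ Set.Icc (0 : ℝ) 1)
    (A : Matrix (Fin nR) (Fin n) ℕ)
    (hA : A ∈ TwoStage.validAssignments Finset.univ Finset.univ μ ((1 + β) * (μ : ℝ)))
    (s : ℝ) (hs : s = TwoStage.meanSim S ((1 + β) * (μ : ℝ)) A)
    (ε : ℝ) (hε : ε = (⌈β * (μ : ℝ)⌉₊ : ℝ) - (⌊β * (μ : ℝ)⌋₊ : ℝ)) :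
    ((∃ k : ℕ, β * (μ : ℝ) = (k : ℝ)) →
      TwoStage.randomSplitValue S n₂ m ≥
        s * (1 - √(β / (2 * Real.pi * (1 + β) ^ 2 * (μ : ℝ))) *
          (2 * √(1 / (1 + β)) + √(1 - β)))) ∧
    TwoStage.randomSplitValue S n₂ m ≥
      s * (1 - √(β / (2 * Real.pi * (1 + β) * (⌊(1 + β) * (μ : ℝ)⌋₊ : ℝ))) *
            (2 * √(1 / (1 + β)) + √(1 - β))
          - (1 + 2 * β) / ((1 + β) * (⌈β * (μ : ℝ)⌉₊ : ℝ)) * ε) *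
        (1 - ε / (⌈(1 + β) * (μ : ℝ)⌉₊ : ℝ)) := by
  obtain ⟨b, hb1, hb2, rfl⟩ := hβ
  have hb1' : (1 : ℝ) ≤ b := by exact_mod_cast hb1
  have hb2' : (b : ℝ) ≤ 100 := by exact_mod_cast hb2
  have hgeneral := TwoStage.randomSplitValue_ge_of_validAssignment hn hμ (by positivity)
    (by linarith) hn₂ hnR hm (fun r p => (hS r p).1) hA hs hε
  refine ⟨?_, hgeneral⟩
  rintro ⟨k, hk⟩
  -- With an integral second-stage load, `ε = 0` and `⌊(1 + β) μ⌋ = (1 + β) μ`.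
  have hε0 : ε = 0 := by rw [hε, hk, Nat.ceil_natCast, Nat.floor_natCast, sub_self]
  have hfloor : ((⌊(1 + (b : ℝ) / 100) * (μ : ℝ)⌋₊ : ℕ) : ℝ) = (1 + (b : ℝ) / 100) * μ := by
    have : (1 + (b : ℝ) / 100) * (μ : ℝ) = ((μ + k : ℕ) : ℝ) := by push_cast; linarith
    rw [this, Nat.floor_natCast]
  rw [hε0, hfloor] at hgeneral
  have e : 2 * Real.pi * (1 + (b : ℝ) / 100) * ((1 + (b : ℝ) / 100) * (μ : ℝ))
      = 2 * Real.pi * (1 + (b : ℝ) / 100) ^ 2 * μ := by ring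
  rw [e] at hgeneral
  simpa using hgeneral
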